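/- Let $k$ be a field of characteristic $0$ and let $h$ be a formal parameter; all algebras are over $k[[h]]$, and $\hat\otimes$ is the $h$-adically completed tensor product over $k[[h]]$. Let $U(sl(2))$ be the $h$-adic completion of the enveloping algebra of $sl(2)$ over $k[[h]]$ (that is, $U(sl(2))[[h]]$), with standard generators $J_\pm,J_0$, $$[J_0,J_\pm]=\pm 2J_\pm,\qquad [J_+,J_-]=J_0,$$ and with the coproduct $\Delta_c$ given by $\Delta_c(J_\delta)=J_\delta\otimes1+1\otimes J_\delta$ $(\delta=\pm,0)$. Let the Jordanian algebra $U_h(sl(2))$ be the $h$-adically complete $k[[h]]$-algebra topologically generated by $X,H,Y$ with the relations $$[H,X]=\tfrac2h\sinh hX,\qquad [H,Y]=-Y\cosh hX-(\cosh hX)\,Y,\qquad [X,Y]=H,$$ and put $T^{\pm1}=e^{\pm hX}$. Let $\sigma(x\otimes y)=y\otimes x$. 1. The expression $(1-T^{-2})/(2h)$ denotes the element $-\frac12\sum_{n\ge0}\frac{(-2)^{n+1}}{(n+1)!}h^nX^{n+1}$ of $U_h(sl(2))$; it satisfies $2h\cdot\frac{1-T^{-2}}{2h}=1-T^{-2}$,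 and $TT^{-1}=1$. There is exactly one $k[[h]]$-algebra map $U(sl(2))\to U_h(sl(2))$ with $$J_+\mapsto\frac{1-T^{-2}}{2h},\qquad J_0\mapsto TH,\qquad J_-\mapsto TY-\frac h2(TH)^2-\frac h8(T^2-1),$$ and it is an isomorphism of algebras. Write $m$ for its inverse, write $J_\delta$ also for the three elements on the right, and put $\tilde\Delta_c=(m^{-1}\hat\otimes m^{-1})\circ\Delta_c\circ m$. 2. There is exactly one $k[[h]]$-algebra map $\Delta_n:U_h(sl(2))\to U_h(sl(2))\hat\otimes U_h(sl(2))$ with $$\Delta_n(X)=X\otimes1+1\otimes X,\quad \Delta_n(Y)=Y\otimes T+T^{-1}\otimes Y,\quad \Delta_n(H)=H\otimes T+T^{-1}\otimes H.$$ 3. The element $V=\exp(-e^{hX}H\otimes hX)$ is invertible, and for $\delta=\pm,0$ $$V^{-1}\Delta_n(J_\delta)V=J_\delta\otimes1+1\otimes J_\delta=\tilde\Delta_c(J_\delta).$$ More generally $V^{-1}\Delta_n(\Phi)V=\tilde\Delta_c(\Phi)$ for all $\Phi\in U_h(sl(2))$. 4. Let $\mathcal R_h=\exp(-hX\otimes e^{hX}H)\exp(e^{hX}H\otimes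 hX)$ be the factorized Ballesteros--Herranz element. Then $\mathcal R_h=\sigma(V)V^{-1}$. Hence $F=V$ (that is, $F=VF_S$ with $F_S=1\otimes1$) satisfies both $F^{-1}\Delta_n(\Phi)F=\tilde\Delta_c(\Phi)$ for all $\Phi\in U_h(sl(2))$ and $\mathcal R_h=\sigma(F)F^{-1}$. Moreover, for every invertible $F=VF_S$ with these two properties one has $\sigma(F_S)=F_S$ and $F_S\,\tilde\Delta_c(J_\delta)\,F_S^{-1}=\tilde\Delta_c(J_\delta)$ for $\delta=\pm,0$. -/

import Mathlib

open scoped PowerSeries TensorProduct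

noncomputable section

universe u

namespace Jordanian

/-! The deformation parameter `h` is the variable of `k⟦X⟧`. -/

section Completion

variable (k : Type u) [Field k]

/-- The formal deformation parameter `h`, as an element of `k[[h]]`. -/
def hbar : k⟦X⟧ := PowerSeries.X

variable (A : Type u) [Ring A] [Algebra k⟦X⟧ A]

/-- The two-sided ideal `hⁿ A` of a `k[[h]]`-algebra `A`. -/
def hIdeal (n : ℕ) : Ideal A where
  carrier := {a | ∃ c : A, a = hbar k ^ n • c}
  add_mem' := by
    rintro _ _ ⟨c, rfl⟩ ⟨d, rfl⟩
    exact ⟨c + d, (smul_add _ _ _).symm⟩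
  zero_mem' := ⟨0, (smul_zero _).symm⟩
  smul_mem' := by
    rintro b _ ⟨c, rfl⟩
    exact ⟨b * c, by simp [smul_eq_mul]⟩

instance (n : ℕ) : (hIdeal k A n).IsTwoSided where
  mul_mem_of_left := by
    rintro _ b ⟨c, rfl⟩
    exact ⟨c * b, by simp⟩

theorem hIdeal_anti {m n : ℕ} (hmn : m ≤ n) : hIdeal k A n ≤ hIdeal k A m := by
  rintro _ ⟨c, rfl⟩
  exact ⟨hbar k ^ (n - m) • c, by rw [smul_smul, ← pow_add, Nat.add_sub_cancel' hmn]⟩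

/-- The compatible sequences in `∏ₙ A / hⁿ A`. -/
def hLimit : Subalgebra k⟦X⟧ ((n : ℕ) → A ⧸ hIdeal k A n) where
  carrier := {a | ∀ (m n : ℕ) (hmn : m ≤ n),
    Ideal.Quotient.factor (hIdeal_anti k A hmn) (a n) = a m}
  mul_mem' := by
    intro a b ha hb m n hmn
    simp only [Pi.mul_apply, map_mul, ha m n hmn, hb m n hmn]
  add_mem' := by
    intro a b ha hb m n hmn
    simp only [Pi.add_apply, map_add, ha m n hmn, hb m n hmn]
  algebraMap_mem' := by
    intro r m n hmn
    rfl

/-- The `h`-adic completion `lim A / hⁿ A` of a `k[[h]]`-algebra `A`. -/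
def HComp : Type u := hLimit k A

instance : Ring (HComp k A) := inferInstanceAs (Ring (hLimit k A))

instance : Algebra k⟦X⟧ (HComp k A) := inferInstanceAs (Algebra k⟦X⟧ (hLimit k A))

variable {A}

/-- The canonical map from an algebra to its `h`-adic completion. -/
def toHComp : A →ₐ[k⟦X⟧] HComp k A where
  toFun a := ⟨fun n => Ideal.Quotient.mk (hIdeal k A n) a, fun _ _ _ => rfl⟩
  map_one' := rfl
  map_mul' _ _ := rfl
  map_zero' := rfl
  map_add' _ _ := rfl
  commutes' _ := rfl

variable {k}
variable {B : Type u} [Ring B] [Algebra k⟦X⟧ B]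

/-- The map `A / hⁿ A → B / hⁿ B` induced by an algebra map `A → B`. -/
def hQuotMap (f : A →ₐ[k⟦X⟧] B) (n : ℕ) : A ⧸ hIdeal k A n →+* B ⧸ hIdeal k B n :=
  Ideal.Quotient.lift (hIdeal k A n) ((Ideal.Quotient.mk (hIdeal k B n)).comp f.toRingHom) (by
    rintro _ ⟨c, rfl⟩
    exact Ideal.Quotient.eq_zero_iff_mem.mpr ⟨f c, map_smul f _ _⟩)

/-- Functoriality of the `h`-adic completion. -/
def mapHComp (f : A →ₐ[k⟦X⟧] B) : HComp k A →ₐ[k⟦X⟧] HComp k B where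
  toFun a := ⟨fun n => hQuotMap f n (a.1 n), by
    intro m n hmn
    have h1 := a.2 m n hmn
    obtain ⟨b, hb⟩ := Ideal.Quotient.mk_surjective (a.1 n)
    rw [← hb] at h1
    change Ideal.Quotient.factor (hIdeal_anti k B hmn) (hQuotMap f n (a.1 n)) =
      hQuotMap f m (a.1 m)
    rw [← h1, ← hb]
    rfl⟩
  map_one' := Subtype.ext (funext fun n => map_one (hQuotMap f n))
  map_mul' a b := Subtype.ext (funext fun n => map_mul (hQuotMap f n) (a.1 n) (b.1 n))
  map_zero' := Subtype.ext (funext fun n => map_zero (hQuotMap f n))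
  map_add' a b := Subtype.ext (funext fun n => map_add (hQuotMap f n) (a.1 n) (b.1 n))
  commutes' r := Subtype.ext (funext fun n =>
    congrArg (Ideal.Quotient.mk (hIdeal k B n)) (f.commutes r))

/-- For `f(t) = ∑ fₙ tⁿ`, the element `f(h x) = ∑ₙ fₙ hⁿ xⁿ` of the completion. -/
def hSeries (f : k⟦X⟧) (x : A) : HComp k A :=
  ⟨fun N => Ideal.Quotient.mk (hIdeal k A N)
      (∑ n ∈ Finset.range N, (PowerSeries.C (PowerSeries.coeff n f) * hbar k ^ n) • x ^ n), by
    intro m n hmn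
    rw [Ideal.Quotient.factor_mk, Ideal.Quotient.mk_eq_mk_iff_sub_mem,
      ← Finset.sum_sdiff (Finset.range_mono hmn), add_sub_cancel_right]
    refine sum_mem fun i hi => ?_
    have hi : m ≤ i := by simpa using (Finset.mem_sdiff.mp hi).2
    exact hIdeal_anti k A hi
      ⟨PowerSeries.C (PowerSeries.coeff i f) • x ^ i, by rw [smul_smul, mul_comm]⟩⟩

/-- For `f(t) = ∑ fₙ tⁿ` with `f₀ = 0`, the element `h⁻¹ f(h x) = ∑ₙ fₙ₊₁ hⁿ xⁿ⁺¹` of the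
completion. -/
def hSeriesDiv (f : k⟦X⟧) (x : A) : HComp k A :=
  ⟨fun N => Ideal.Quotient.mk (hIdeal k A N)
      (∑ n ∈ Finset.range N,
        (PowerSeries.C (PowerSeries.coeff (n + 1) f) * hbar k ^ n) • x ^ (n + 1)), by
    intro m n hmn
    rw [Ideal.Quotient.factor_mk, Ideal.Quotient.mk_eq_mk_iff_sub_mem,
      ← Finset.sum_sdiff (Finset.range_mono hmn), add_sub_cancel_right]
    refine sum_mem fun i hi => ?_
    have hi : m ≤ i := by simpa using (Finset.mem_sdiff.mp hi).2
    exact hIdeal_anti k A hi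
      ⟨PowerSeries.C (PowerSeries.coeff (i + 1) f) • x ^ (i + 1), by
        rw [smul_smul, mul_comm]⟩⟩

/-- The exponential `exp (h x)` in the completion. -/
def hExp [CharZero k] (x : A) : HComp k A := hSeries (PowerSeries.exp k) x

variable (k A)

/-- The completed tensor square `A ⊗̂ A` over `k[[h]]`. -/
abbrev Tens : Type u := HComp k (A ⊗[k⟦X⟧] A)

variable {k A}

/-- The pure tensor `a ⊗ b` in the completed tensor square. -/
def tens (a b : A) : Tens k A := toHComp k (a ⊗ₜ[k⟦X⟧] b)

variable (k A)

/-- The flip `σ (a ⊗ b) = b ⊗ a` of the completed tensor square. -/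
def flip : Tens k A →ₐ[k⟦X⟧] Tens k A :=
  mapHComp (Algebra.TensorProduct.comm k⟦X⟧ A A : A ⊗[k⟦X⟧] A →ₐ[k⟦X⟧] A ⊗[k⟦X⟧] A)

variable {k A}

/-- The completed tensor square `f ⊗̂ f` of an algebra map `f`. -/
def tensMap (f : A →ₐ[k⟦X⟧] B) : Tens k A →ₐ[k⟦X⟧] Tens k B :=
  mapHComp (Algebra.TensorProduct.map f f)

variable (k A)

/-- The map `A ⊗ A → Â ⊗ Â` induced by the map of `A` to its completion. -/
def tensIncl : A ⊗[k⟦X⟧] A →ₐ[k⟦X⟧] HComp k A ⊗[k⟦X⟧] HComp k A :=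
  Algebra.TensorProduct.map (toHComp k (A := A)) (toHComp k (A := A))

end Completion

section Classical

attribute [local instance 100] LieRing.ofAssociativeRing

variable (k : Type u) [Field k]

/-- The Lie algebra `sl(2)` of traceless `2 × 2` matrices, with scalars extended to `k[[h]]`. -/
abbrev sl2 := LieAlgebra.SpecialLinear.sl (Fin 2) k⟦X⟧

/-- The raising matrix of `sl(2)`. -/
def slPlus : sl2 k := ⟨!![0, 1; 0, 0], by
  change Matrix.trace (_ : Matrix (Fin 2) (Fin 2) k⟦X⟧) = 0
  simp [Matrix.trace_fin_two]⟩

/-- The diagonal matrix of `sl(2)`. -/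
def slZero : sl2 k := ⟨!![1, 0; 0, -1], by
  change Matrix.trace (_ : Matrix (Fin 2) (Fin 2) k⟦X⟧) = 0
  simp [Matrix.trace_fin_two]⟩

/-- The lowering matrix of `sl(2)`. -/
def slMinus : sl2 k := ⟨!![0, 0; 1, 0], by
  change Matrix.trace (_ : Matrix (Fin 2) (Fin 2) k⟦X⟧) = 0
  simp [Matrix.trace_fin_two]⟩

theorem sl_relations :
    ⁅slZero k, slPlus k⁆ = (2 : k⟦X⟧) • slPlus k ∧
    ⁅slZero k, slMinus k⁆ = (-2 : k⟦X⟧) • slMinus k ∧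
    ⁅slPlus k, slMinus k⁆ = slZero k := by
  refine ⟨?_, ?_, ?_⟩ <;> apply Subtype.ext <;> apply Matrix.ext <;> intro i j <;>
    fin_cases i <;> fin_cases j <;>
    simp [slPlus, slZero, slMinus, Ring.lie_def, one_add_one_eq_two, sub_eq_add_neg] <;>
    norm_num

/-- The classical algebra `U(sl(2))[[h]]`: the `h`-adic completion of the enveloping algebra
of `sl(2)` over `k[[h]]`. -/
abbrev Ucl : Type u := HComp k (UniversalEnvelopingAlgebra k⟦X⟧ (sl2 k))

/-- An element of `sl(2)` in the classical algebra. -/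
def clGen (x : sl2 k) : Ucl k := toHComp k (UniversalEnvelopingAlgebra.ι k⟦X⟧ x)

/-- The diagonal `x ↦ x ⊗ 1 + 1 ⊗ x` as a Lie algebra map. -/
def primLie : sl2 k →ₗ⁅k⟦X⟧⁆
    (UniversalEnvelopingAlgebra k⟦X⟧ (sl2 k) ⊗[k⟦X⟧] UniversalEnvelopingAlgebra k⟦X⟧ (sl2 k)) where
  toFun x := UniversalEnvelopingAlgebra.ι k⟦X⟧ x ⊗ₜ 1 + 1 ⊗ₜ UniversalEnvelopingAlgebra.ι k⟦X⟧ x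
  map_add' x y := by
    simp only [map_add, TensorProduct.add_tmul, TensorProduct.tmul_add]; abel
  map_smul' r x := by
    simp only [map_smul, RingHom.id_apply, smul_add, TensorProduct.smul_tmul',
      TensorProduct.tmul_smul]
  map_lie' := by
    intro x y
    simp only [LieHom.map_lie, Ring.lie_def, mul_add, add_mul, TensorProduct.sub_tmul,
      TensorProduct.tmul_sub, Algebra.TensorProduct.tmul_mul_tmul, one_mul, mul_one]
    abel

/-- The classical cocommutative coproduct `Δ_c` on `U(sl(2))[[h]]`, the continuous algebra map
with `Δ_c x = x ⊗ 1 + 1 ⊗ x` on `sl(2)`. -/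
def coprodCl : Ucl k →ₐ[k⟦X⟧] Tens k (Ucl k) :=
  mapHComp ((tensIncl k (UniversalEnvelopingAlgebra k⟦X⟧ (sl2 k))).comp
    (UniversalEnvelopingAlgebra.lift k⟦X⟧ (primLie k)))

end Classical

section Quantum

variable (k : Type u) [Field k] [CharZero k]

/-- The names of the three generators. -/
inductive Gen : Type
  | X | H | Y

/-- The free noncommutative `k[[h]]`-algebra on `X, H, Y`. -/
abbrev Free : Type u := FreeAlgebra k⟦X⟧ Gen

/-- A generator in the completed free algebra. -/
def freeGen (g : Gen) : HComp k (Free k) := toHComp k (FreeAlgebra.ι k⟦X⟧ g)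

/-- The series `e^t - e^{-t} = 2 sinh t`. -/
def twoSinh : k⟦X⟧ := PowerSeries.exp k - PowerSeries.rescale (-1) (PowerSeries.exp k)

/-- The series `cosh t`. -/
def coshSeries : k⟦X⟧ :=
  PowerSeries.C (1 / 2) * (PowerSeries.exp k + PowerSeries.rescale (-1) (PowerSeries.exp k))

/-- The element `(2 / h) sinh (h X)` of the completed free algebra. -/
def freeSinh : HComp k (Free k) := hSeriesDiv (twoSinh k) (FreeAlgebra.ι k⟦X⟧ Gen.X)

/-- The element `cosh (h X)` of the completed free algebra. -/
def freeCosh : HComp k (Free k) := hSeries (coshSeries k) (FreeAlgebra.ι k⟦X⟧ Gen.X)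

/-- The defining relations `[H, X] = (2 / h) sinh (h X)`,
`[H, Y] = -Y cosh (h X) - cosh (h X) Y` and `[X, Y] = H`. -/
inductive JRel : HComp k (Free k) → HComp k (Free k) → Prop
  | HX : JRel (freeGen k Gen.H * freeGen k Gen.X - freeGen k Gen.X * freeGen k Gen.H)
      (freeSinh k)
  | HY : JRel (freeGen k Gen.H * freeGen k Gen.Y - freeGen k Gen.Y * freeGen k Gen.H)
      (-(freeGen k Gen.Y * freeCosh k) - freeCosh k * freeGen k Gen.Y)
  | XY : JRel (freeGen k Gen.X * freeGen k Gen.Y - freeGen k Gen.Y * freeGen k Gen.X)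
      (freeGen k Gen.H)

/-- The quotient of the completed free algebra by the two-sided ideal of the relations, before
the passage to the closure of this ideal. -/
abbrev PreU : Type u := RingQuot (JRel k)

/-- The Jordanian algebra `U_h(sl(2))`, topologically generated over `k[[h]]` by `X, H, Y` with
the relations `JRel`. Completing the quotient is the same as dividing by the closure of the ideal
of relations. -/
abbrev Uh : Type u := HComp k (PreU k)

/-- A generator before completion. -/
def preGen (g : Gen) : PreU k := RingQuot.mkAlgHom k⟦X⟧ (JRel k) (freeGen k g)

/-- A generator of `U_h(sl(2))`. -/
def gen (g : Gen) : Uh k := toHComp k (preGen k g)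

/-- The element `T = e^{hX}` of `U_h(sl(2))`. -/
def T : Uh k := hExp (preGen k Gen.X)

/-- The element `T⁻¹ = e^{-hX}` of `U_h(sl(2))`. -/
def Tinv : Uh k := hExp (-preGen k Gen.X)

/-- `J₊ = (1 - T⁻²) / (2 h)`, by the power series `(1 - e^{-2t}) / 2` at `t = h X`, divided
by `h`. -/
def JPlus : Uh k :=
  hSeriesDiv (PowerSeries.C (1 / 2) * (1 - PowerSeries.rescale (-2) (PowerSeries.exp k)))
    (preGen k Gen.X)

/-- `J₀ = T H`. -/
def JZero : Uh k := T k * gen k Gen.H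

/-- `J₋ = T Y - (h / 2) (T H)² - (h / 8) (T² - 1)`. -/
def JMinus : Uh k :=
  T k * gen k Gen.Y - (PowerSeries.C (1 / 2) * hbar k) • (T k * gen k Gen.H) ^ 2
    - (PowerSeries.C (1 / 8) * hbar k) • (T k ^ 2 - 1)

/-- The Jordanian coproduct `Δ_n` on `U_h(sl(2))`, by its values on the generators. -/
structure IsJordanianCoproduct (D : Uh k →ₐ[k⟦X⟧] Tens k (Uh k)) : Prop where
  onX : D (gen k Gen.X) = tens (gen k Gen.X) 1 + tens 1 (gen k Gen.X)
  onY : D (gen k Gen.Y) = tens (gen k Gen.Y) (T k) + tens (Tinv k) (gen k Gen.Y)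
  onH : D (gen k Gen.H) = tens (gen k Gen.H) (T k) + tens (Tinv k) (gen k Gen.H)

/-- The algebra map sends `J₊, J₀, J₋` to the expressions of the minimal twist map. -/
structure IsMinimalTwistMap (f : Ucl k →ₐ[k⟦X⟧] Uh k) : Prop where
  onPlus : f (clGen k (slPlus k)) = JPlus k
  onZero : f (clGen k (slZero k)) = JZero k
  onMinus : f (clGen k (slMinus k)) = JMinus k

/-- The twist `V = exp (-e^{hX} H ⊗ h X)`. -/
def twistV : Tens k (Uh k) :=
  hExp (-((T k * gen k Gen.H) ⊗ₜ[k⟦X⟧] gen k Gen.X))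

/-- The factorized universal matrix `R_h = exp (-h X ⊗ e^{hX} H) exp (e^{hX} H ⊗ h X)`. -/
def RMat : Tens k (Uh k) :=
  hExp (-(gen k Gen.X ⊗ₜ[k⟦X⟧] (T k * gen k Gen.H))) *
    hExp ((T k * gen k Gen.H) ⊗ₜ[k⟦X⟧] gen k Gen.X)

variable {k}

/-- The classical coproduct transported to `U_h(sl(2))` along the isomorphism `e`, that is
`(e ⊗̂ e) ∘ Δ_c ∘ e⁻¹`. -/
def coprodTransported (e : Ucl k ≃ₐ[k⟦X⟧] Uh k) : Uh k →ₐ[k⟦X⟧] Tens k (Uh k) :=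
  ((tensMap (e : Ucl k →ₐ[k⟦X⟧] Uh k)).comp (coprodCl k)).comp
    (e.symm : Uh k →ₐ[k⟦X⟧] Ucl k)

/-- `F` twists the coproduct `D` into the transported classical one:
`F⁻¹ D(Φ) F = Δ̃_c(Φ)` for all `Φ`. -/
def IsTwist (D : Uh k →ₐ[k⟦X⟧] Tens k (Uh k)) (e : Ucl k ≃ₐ[k⟦X⟧] Uh k)
    (F : (Tens k (Uh k))ˣ) : Prop :=
  ∀ Φ : Uh k, ↑F⁻¹ * D Φ * ↑F = coprodTransported e Φ

/-- `F` factorizes the universal matrix: `R_h = (σ F) F⁻¹`. -/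
def Factorizes (F : (Tens k (Uh k))ˣ) : Prop :=
  RMat k = flip k (Uh k) ↑F * ↑F⁻¹

end Quantum

end Jordanian

end

/-!
All computations take place in `h`-adically complete `k[[h]]`-algebras, and no algebra is ever
shown to be free of `h`-torsion: a Poincaré-Birkhoff-Witt theorem is not needed. The substitute for
division by `h` is `eq_zero_of_family`: a family whose members reproduce each other up to a factor
`h` vanishes. It yields a functional calculus, `hEval x f = f(h x)` and
`hEvalDiv x f = (f(h x) - f(0)) / h`, with rules for products, composition (`hEval_subst`),
commutators (`commutator_hEval`) and second-order commutators (`hEval_commutator`, which is what is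
needed because `[X, Y] = H` does not commute with `X`).

The isomorphism comes from a bijection between triples. In every complete algebra, a triple that
satisfies the Jordanian relations gives an `sl(2)` triple by the formulas for `J₊, J₀, J₋`
(`JTriple.slTriple`). Conversely `J₊ = φ(hX) / h` with `φ(t) = (1 - e^{-2t}) / 2` is inverted by the
compositional inverse of `φ`, and this turns an `sl(2)` triple into a Jordanian one
(`SlTriple.jTriple`). The hardest relation, the one for `[H, Y]`, is settled in both directions by
`zm_identity`: modulo the other relations it is `T⁻²` times `[J₀, J₋] = -2 J₋`. Both algebras have
the universal property for such triples in complete algebras (`jordanLift`, `slLift`), since algebra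
maps are automatically continuous (`HComp.algHom_ext`), so that they are isomorphic.

The Jordanian coproduct is *defined* as `Φ ↦ V Δ̃_c(Φ) V⁻¹`, so that it is multiplicative and the
twist property holds by construction. Its values on the generators follow from the three
conjugation formulas `twist_mul_plus`, `twist_mul_zero` and `twist_mul_minus` for the primitive
elements `J ⊗ 1 + 1 ⊗ J`. Here `V = exp (-h J₀ ⊗ X)` acts on the first factor through the grading by
`J₀` (`twist_mul_left`), and on the second factor through commutators with `X`, which vanish after
the second (`twist_mul_right`). The factorization of `R_h` and the statements on `F_S` are then
formal.
-/

noncomputable section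

universe u

namespace Jordanian

/-! ### Completeness and summation of `h`-adic series -/

section Complete

variable (k : Type u) [Field k]

theorem mem_hIdeal {A : Type u} [Ring A] [Algebra k⟦X⟧ A] {n : ℕ} {a : A} :
    a ∈ hIdeal k A n ↔ ∃ c : A, a = hbar k ^ n • c := Iff.rfl

variable {k}

@[ext]
theorem HComp.ext {A : Type u} [Ring A] [Algebra k⟦X⟧ A] {a b : HComp k A}
    (h : ∀ n, a.1 n = b.1 n) : a = b := Subtype.ext (funext h)

theorem mk_smul_eq_zero {A : Type u} [Ring A] [Algebra k⟦X⟧ A] (n : ℕ) (c : A) :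
    Ideal.Quotient.mk (hIdeal k A n) (hbar k ^ n • c) = 0 :=
  Ideal.Quotient.eq_zero_iff_mem.mpr ⟨c, rfl⟩

theorem HComp.val_smul_eq_zero {A : Type u} [Ring A] [Algebra k⟦X⟧ A] (n : ℕ) (c : HComp k A) :
    (hbar k ^ n • c).1 n = 0 := by
  obtain ⟨b, hb⟩ := Ideal.Quotient.mk_surjective (c.1 n)
  change hbar k ^ n • c.1 n = 0
  rw [← hb]
  exact mk_smul_eq_zero n b

variable (k) in
/-- The formal sum `∑ hⁿ dₙ` in the completion of `A`, for a sequence in `A`. -/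
def hSumHat {A : Type u} [Ring A] [Algebra k⟦X⟧ A] (d : ℕ → A) : HComp k A :=
  ⟨fun N => Ideal.Quotient.mk (hIdeal k A N) (∑ n ∈ Finset.range N, hbar k ^ n • d n), by
    intro m n hmn
    rw [Ideal.Quotient.factor_mk, Ideal.Quotient.mk_eq_mk_iff_sub_mem,
      ← Finset.sum_sdiff (Finset.range_mono hmn), add_sub_cancel_right]
    refine sum_mem fun i hi => ?_
    have hi : m ≤ i := by simpa using (Finset.mem_sdiff.mp hi).2
    exact hIdeal_anti k A hi ⟨d i, rfl⟩⟩

/-- The kernel of the projection `lim A / hᵐ A → A / hⁿ A` is generated by `hⁿ`. -/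
theorem HComp.exists_smul_of_val_eq_zero {A : Type u} [Ring A] [Algebra k⟦X⟧ A] {n : ℕ}
    {a : HComp k A} (ha : a.1 n = 0) : ∃ c, a = hbar k ^ n • c := by
  -- Successive representatives `b (n + m)` of `a` differ by `hⁿ⁺ᵐ dₘ`, so `a` is the telescoping
  -- series `b n + ∑ hⁿ⁺ᵐ dₘ`, and `b n` is itself divisible by `hⁿ`.
  choose b hb using fun m => Ideal.Quotient.mk_surjective (a.1 m)
  have hstep : ∀ m, ∃ d : A, b (n + (m + 1)) - b (n + m) = hbar k ^ (n + m) • d := by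
    intro m
    refine (mem_hIdeal k).1 ((Ideal.Quotient.mk_eq_mk_iff_sub_mem _ _).1 ?_)
    rw [hb, ← a.2 (n + m) (n + (m + 1)) (by omega), ← hb, Ideal.Quotient.factor_mk]
  choose d hd using hstep
  obtain ⟨c₀, hc₀⟩ := (mem_hIdeal k).1 (Ideal.Quotient.eq_zero_iff_mem.1 ((hb n).trans ha))
  refine ⟨toHComp k c₀ + hSumHat k d, ?_⟩
  have hsum : ∀ N, b (n + N) = hbar k ^ n • (c₀ + ∑ m ∈ Finset.range N, hbar k ^ m • d m) := by
    intro N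
    induction N with
    | zero => simpa using hc₀
    | succ N ih =>
      rw [← sub_add_cancel (b (n + (N + 1))) (b (n + N)), hd, ih, Finset.sum_range_succ, pow_add,
        mul_smul, ← smul_add]
      congr 1
      abel
  ext N
  rw [← a.2 N (n + N) (by omega), ← hb, Ideal.Quotient.factor_mk, hsum]
  rfl

variable (k) in
/-- A `k[[h]]`-algebra is `h`-adically complete and separated if it agrees with its completion. -/
class HComplete (C : Type u) [Ring C] [Algebra k⟦X⟧ C] : Prop where
  bijective : Function.Bijective (toHComp k (A := C))

instance {A : Type u} [Ring A] [Algebra k⟦X⟧ A] : HComplete k (HComp k A) where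
  bijective := by
    constructor
    · refine (injective_iff_map_eq_zero _).2 fun a ha => ?_
      ext n
      have h : (toHComp k a).1 n = 0 := by rw [ha]; rfl
      obtain ⟨c, rfl⟩ := (mem_hIdeal k).1 (Ideal.Quotient.eq_zero_iff_mem.1 h)
      exact HComp.val_smul_eq_zero n c
    · intro b
      -- `b` is the limit of its representatives `β n`; its `n`-th component is that of `β n`.
      choose β hβ using fun m => Ideal.Quotient.mk_surjective (b.1 m)
      have hcomp : ∀ m n, m ≤ n → (β n).1 m = (β m).1 m := by
        intro m n hmn
        have h : β n - β m ∈ hIdeal k (HComp k A) m := by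
          refine (Ideal.Quotient.mk_eq_mk_iff_sub_mem _ _).1 ?_
          rw [hβ, ← b.2 m n hmn, ← hβ, Ideal.Quotient.factor_mk]
        obtain ⟨c, hc⟩ := (mem_hIdeal k).1 h
        have h0 : (β n - β m).1 m = 0 := by rw [hc]; exact HComp.val_smul_eq_zero m c
        exact sub_eq_zero.1 h0
      refine ⟨⟨fun n => (β n).1 n, fun m n hmn => ?_⟩, ?_⟩
      · rw [(β n).2 m n hmn, hcomp m n hmn]
      · ext n
        rw [← hβ]
        refine (Ideal.Quotient.mk_eq_mk_iff_sub_mem _ _).2 ?_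
        exact HComp.exists_smul_of_val_eq_zero (sub_self ((β n).1 n))

variable (k) in
/-- A complete algebra is isomorphic to its completion. -/
def hCompEquiv (C : Type u) [Ring C] [Algebra k⟦X⟧ C] [HComplete k C] : C ≃ₐ[k⟦X⟧] HComp k C :=
  AlgEquiv.ofBijective (toHComp k) HComplete.bijective

variable {A : Type u} [Ring A] [Algebra k⟦X⟧ A]
variable {C : Type u} [Ring C] [Algebra k⟦X⟧ C]

theorem mapHComp_toHComp (f : A →ₐ[k⟦X⟧] C) (a : A) :
    mapHComp f (toHComp k a) = toHComp k (f a) := rfl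

/-- The extension of an algebra map into a complete algebra to the completion. -/
def hLift [HComplete k C] (f : A →ₐ[k⟦X⟧] C) : HComp k A →ₐ[k⟦X⟧] C :=
  ((hCompEquiv k C).symm : HComp k C →ₐ[k⟦X⟧] C).comp (mapHComp f)

@[simp]
theorem hLift_toHComp [HComplete k C] (f : A →ₐ[k⟦X⟧] C) (a : A) :
    hLift f (toHComp k a) = f a :=
  (hCompEquiv k C).symm_apply_apply (f a)

/-- A complete algebra is `h`-adically separated. -/
theorem eq_zero_of_forall_smul [HComplete k C] {a : C} (h : ∀ n, ∃ c, a = hbar k ^ n • c) :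
    a = 0 := by
  refine (injective_iff_map_eq_zero _).1 (HComplete.bijective (k := k) (C := C)).1 a ?_
  ext n
  obtain ⟨c, rfl⟩ := h n
  exact mk_smul_eq_zero n c

/-- Algebra maps are automatically `h`-adically continuous, so that they are determined by their
values on a dense subalgebra. -/
theorem HComp.algHom_ext [HComplete k C] {f g : HComp k A →ₐ[k⟦X⟧] C}
    (h : ∀ a, f (toHComp k a) = g (toHComp k a)) : f = g := by
  ext a
  refine sub_eq_zero.1 (eq_zero_of_forall_smul (k := k) fun n => ?_)
  obtain ⟨b, hb⟩ := Ideal.Quotient.mk_surjective (a.1 n)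
  obtain ⟨c, hc⟩ := HComp.exists_smul_of_val_eq_zero (n := n) (a := a - toHComp k b)
    (sub_eq_zero.2 hb.symm)
  refine ⟨f c - g c, ?_⟩
  rw [smul_sub, ← map_smul f, ← map_smul g, ← hc, map_sub, map_sub, h]
  abel

/-- A family which reproduces itself up to a factor `h` vanishes. Applied with
the coefficient sequence as index, this proves identities between `h`-adic series without dividing
by `h`, which is not possible as torsion is not excluded. -/
theorem eq_zero_of_family [HComplete k C] {ι : Type*} (F : ι → C)
    (hF : ∀ i, ∃ j c, F i = hbar k • (c * F j)) (i : ι) : F i = 0 := by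
  refine eq_zero_of_forall_smul (k := k) fun n => ?_
  induction n generalizing i with
  | zero => exact ⟨F i, by simp⟩
  | succ n ih =>
    obtain ⟨j, c, hj⟩ := hF i
    obtain ⟨d, hd⟩ := ih j
    exact ⟨c * d, by rw [hj, hd, mul_smul_comm, smul_smul, pow_succ']⟩

variable (k) in
/-- The sum `∑ hⁿ dₙ` in a complete algebra. -/
def hSum [HComplete k C] (d : ℕ → C) : C := (hCompEquiv k C).symm (hSumHat k d)

theorem hSumHat_eq (d : ℕ → A) :
    hSumHat k d = toHComp k (d 0) + hbar k • hSumHat k fun n => d (n + 1) := by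
  ext N
  change Ideal.Quotient.mk (hIdeal k A N) _ = Ideal.Quotient.mk (hIdeal k A N)
    (d 0 + hbar k • ∑ n ∈ Finset.range N, hbar k ^ n • d (n + 1))
  have h : d 0 + hbar k • ∑ n ∈ Finset.range N, hbar k ^ n • d (n + 1) =
      (∑ n ∈ Finset.range N, hbar k ^ n • d n) + hbar k ^ N • d N := by
    rw [← Finset.sum_range_succ, Finset.sum_range_succ', Finset.smul_sum, pow_zero, one_smul,
      add_comm]
    simp only [smul_smul, pow_succ']
  rw [h, map_add, mk_smul_eq_zero, add_zero]

/-- The recursion for `∑ hⁿ dₙ`; it determines the sum because the algebra is separated. -/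
theorem hSum_eq [HComplete k C] (d : ℕ → C) :
    hSum k d = d 0 + hbar k • hSum k fun n => d (n + 1) := by
  rw [hSum, hSumHat_eq, map_add, map_smul]
  congr 1
  exact (hCompEquiv k C).symm_apply_apply (d 0)

theorem map_hSum [HComplete k C] {C' : Type u} [Ring C'] [Algebra k⟦X⟧ C'] [HComplete k C']
    (f : C →ₗ[k⟦X⟧] C') (d : ℕ → C) : f (hSum k d) = hSum k fun n => f (d n) := by
  refine sub_eq_zero.1 (eq_zero_of_family (k := k)
    (fun d : ℕ → C => f (hSum k d) - hSum k fun n => f (d n)) (fun d => ?_) d)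
  refine ⟨fun n => d (n + 1), 1, ?_⟩
  rw [hSum_eq d, hSum_eq fun n => f (d n), map_add, map_smul, one_mul, smul_sub]
  abel

theorem hSum_add [HComplete k C] (d e : ℕ → C) :
    hSum k (fun n => d n + e n) = hSum k d + hSum k e := by
  refine sub_eq_zero.1 (eq_zero_of_family (k := k)
    (fun d : (ℕ → C) × (ℕ → C) => hSum k (fun n => d.1 n + d.2 n) - (hSum k d.1 + hSum k d.2))
    (fun d => ?_) (d, e))
  refine ⟨(fun n => d.1 (n + 1), fun n => d.2 (n + 1)), 1, ?_⟩
  rw [hSum_eq d.1, hSum_eq d.2, hSum_eq fun n => d.1 n + d.2 n, one_mul, smul_sub, smul_add]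
  abel

/-- The Cauchy product of two `h`-adic series. -/
theorem hSum_mul [HComplete k C] (d e : ℕ → C) :
    hSum k d * hSum k e = hSum k fun n => ∑ p ∈ Finset.HasAntidiagonal.antidiagonal n, d p.1 * e p.2 := by
  refine sub_eq_zero.1 (eq_zero_of_family (k := k) (fun d : ℕ → C => hSum k d * hSum k e -
    hSum k fun n => ∑ p ∈ Finset.HasAntidiagonal.antidiagonal n, d p.1 * e p.2) (fun d => ?_) d)
  refine ⟨fun n => d (n + 1), 1, ?_⟩
  have h : (hSum k fun n => ∑ p ∈ Finset.HasAntidiagonal.antidiagonal n, d p.1 * e p.2) =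
      d 0 * hSum k e + hbar k • hSum k fun n =>
        ∑ p ∈ Finset.HasAntidiagonal.antidiagonal n, d (p.1 + 1) * e p.2 := by
    have hl := map_hSum (k := k) (LinearMap.mulLeft k⟦X⟧ (d 0)) e
    simp only [LinearMap.mulLeft_apply] at hl
    rw [hl, hSum_eq, hSum_eq fun n => d 0 * e n]
    simp only [Finset.Nat.sum_antidiagonal_succ, hSum_add, smul_add, Finset.Nat.antidiagonal_zero,
      Finset.sum_singleton]
    abel
  rw [h, hSum_eq d, one_mul, smul_sub, add_mul, smul_mul_assoc]
  abel

end Complete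

/-! ### Power series in `h x` -/

section Calculus

open PowerSeries (coeff constantCoeff derivative)

variable {k : Type u} [Field k] {C : Type u} [Ring C] [Algebra k⟦X⟧ C] [HComplete k C]

/-- The series `(f(t) - f(0)) / t`. -/
def tail (f : k⟦X⟧) : k⟦X⟧ := PowerSeries.mk fun n => coeff (n + 1) f

@[simp] theorem coeff_tail (n : ℕ) (f : k⟦X⟧) : coeff n (tail f) = coeff (n + 1) f :=
  PowerSeries.coeff_mk _ _

theorem eq_C_add_X_mul_tail (f : k⟦X⟧) :
    f = PowerSeries.C (constantCoeff f) + PowerSeries.X * tail f := by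
  rw [add_comm]; exact PowerSeries.eq_X_mul_shift_add_const f

theorem tail_add (f g : k⟦X⟧) : tail (f + g) = tail f + tail g := by ext; simp

theorem tail_C (c : k) : tail (PowerSeries.C c) = 0 := by
  ext n; simp

/-- The discrete Leibniz rule for `tail`. -/
theorem tail_mul (f g : k⟦X⟧) :
    tail (f * g) = tail f * g + PowerSeries.C (constantCoeff f) * tail g := by
  have h : PowerSeries.X * tail (f * g) =
      PowerSeries.X * (tail f * g + PowerSeries.C (constantCoeff f) * tail g) := by
    have hf := eq_C_add_X_mul_tail f
    have hg := eq_C_add_X_mul_tail g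
    have hfg := eq_C_add_X_mul_tail (f * g)
    rw [map_mul, map_mul] at hfg
    linear_combination -hfg + g * hf + PowerSeries.C (constantCoeff f) * hg
  exact mul_left_cancel₀ PowerSeries.X_ne_zero h

theorem derivative_eq_tail (f : k⟦X⟧) :
    derivative k f = tail f + PowerSeries.X * derivative k (tail f) := by
  conv_lhs => rw [eq_C_add_X_mul_tail f]
  simp [Derivation.leibniz, add_comm]

theorem derivative_derivative_eq_tail (f : k⟦X⟧) :
    derivative k (derivative k f) =
      2 * derivative k (tail f) + PowerSeries.X * derivative k (derivative k (tail f)) := by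
  rw [derivative_eq_tail f]
  simp [Derivation.leibniz]
  ring

theorem hSum_zero : hSum k (fun _ => (0 : C)) = 0 := by
  simpa using (map_hSum (k := k) (0 : C →ₗ[k⟦X⟧] C) fun _ => 0).symm

/-- The ring map `f ↦ f(h x) = ∑ fₙ hⁿ xⁿ`. -/
def hEval (x : C) : k⟦X⟧ →+* C where
  toFun f := hSum k fun n => PowerSeries.C (coeff n f) • x ^ n
  map_zero' := by simp [hSum_zero]
  map_one' := by
    rw [hSum_eq]
    simp [PowerSeries.coeff_one, hSum_zero]
  map_add' f g := by simp [add_smul, hSum_add]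
  map_mul' f g := by
    rw [hSum_mul]
    congr 1
    ext n
    rw [PowerSeries.coeff_mul, map_sum, Finset.sum_smul]
    refine Finset.sum_congr rfl fun p hp => ?_
    rw [smul_mul_smul_comm, ← pow_add, Finset.HasAntidiagonal.mem_antidiagonal.1 hp, map_mul]

/-- The additive map `f ↦ h⁻¹ (f(h x) - f(0)) = ∑ fₙ₊₁ hⁿ xⁿ⁺¹`. -/
def hEvalDiv (x : C) : k⟦X⟧ →+ C where
  toFun f := x * hEval x (tail f)
  map_zero' := by
    have : tail (0 : k⟦X⟧) = 0 := by ext; simp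
    simp [this]
  map_add' f g := by rw [tail_add, map_add, mul_add]

theorem hEvalDiv_apply (x : C) (f : k⟦X⟧) : hEvalDiv x f = x * hEval x (tail f) := rfl

theorem hEvalDiv_eq_hSum (x : C) (f : k⟦X⟧) :
    hEvalDiv x f = hSum k fun n => PowerSeries.C (coeff (n + 1) f) • x ^ (n + 1) := by
  have h := map_hSum (k := k) (LinearMap.mulLeft k⟦X⟧ x)
    fun n => PowerSeries.C (coeff (n + 1) f) • x ^ n
  simp only [LinearMap.mulLeft_apply, mul_smul_comm, ← pow_succ'] at h
  rw [← h, hEvalDiv_apply]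
  simp [hEval]

theorem hEval_eq (x : C) (f : k⟦X⟧) :
    hEval x f = PowerSeries.C (constantCoeff f) • (1 : C) + hbar k • hEvalDiv x f := by
  change hSum k _ = _
  rw [hSum_eq, hEvalDiv_eq_hSum]
  simp

theorem hEval_C (x : C) (c : k) : hEval x (PowerSeries.C c) = PowerSeries.C c • (1 : C) := by
  rw [hEval_eq, hEvalDiv_apply, tail_C]; simp

theorem hEvalDiv_C (x : C) (c : k) : hEvalDiv x (PowerSeries.C c) = 0 := by
  rw [hEvalDiv_apply, tail_C, map_zero, mul_zero]

theorem hEvalDiv_one (x : C) : hEvalDiv x (1 : k⟦X⟧) = 0 := by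
  simpa using hEvalDiv_C x (1 : k)

theorem hEvalDiv_X (x : C) : hEvalDiv x (PowerSeries.X : k⟦X⟧) = x := by
  have : tail (PowerSeries.X : k⟦X⟧) = 1 := by
    ext n; simp [PowerSeries.coeff_X, PowerSeries.coeff_one]
  rw [hEvalDiv_apply, this, map_one, mul_one]

theorem hEval_X (x : C) : hEval x (PowerSeries.X : k⟦X⟧) = hbar k • x := by
  rw [hEval_eq, hEvalDiv_X]; simp

theorem hEval_C_mul (x : C) (c : k) (f : k⟦X⟧) :
    hEval x (PowerSeries.C c * f) = PowerSeries.C c • hEval x f := by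
  rw [map_mul, hEval_C, smul_mul_assoc, one_mul]

theorem hEvalDiv_mul (x : C) (f g : k⟦X⟧) :
    hEvalDiv x (f * g) =
      hEvalDiv x f * hEval x g + PowerSeries.C (constantCoeff f) • hEvalDiv x g := by
  simp only [hEvalDiv_apply, tail_mul, map_add, map_mul, mul_add, mul_smul_comm,
    mul_assoc, hEval_C, smul_mul_assoc, one_mul]

theorem hEvalDiv_C_mul (x : C) (c : k) (f : k⟦X⟧) :
    hEvalDiv x (PowerSeries.C c * f) = PowerSeries.C c • hEvalDiv x f := by
  rw [hEvalDiv_mul, hEvalDiv_C, zero_mul, zero_add, PowerSeries.constantCoeff_C]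

/-- The recursion that feeds `eq_zero_of_family`. -/
theorem hEval_eq_tail (x : C) (f : k⟦X⟧) :
    hEval x f = PowerSeries.C (constantCoeff f) • (1 : C) + hbar k • (x * hEval x (tail f)) :=
  hEval_eq x f

theorem map_hEval {C' : Type u} [Ring C'] [Algebra k⟦X⟧ C'] [HComplete k C']
    (φ : C →ₐ[k⟦X⟧] C') (x : C) (f : k⟦X⟧) : φ (hEval x f) = hEval (φ x) f := by
  have h := map_hSum (k := k) φ.toLinearMap fun n => PowerSeries.C (coeff n f) • x ^ n
  simp only [AlgHom.toLinearMap_apply, map_smul, map_pow] at h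
  exact h

theorem map_hEvalDiv {C' : Type u} [Ring C'] [Algebra k⟦X⟧ C'] [HComplete k C']
    (φ : C →ₐ[k⟦X⟧] C') (x : C) (f : k⟦X⟧) : φ (hEvalDiv x f) = hEvalDiv (φ x) f := by
  rw [hEvalDiv_apply, map_mul, map_hEval, hEvalDiv_apply]

theorem hSumHat_eq_hSum {A : Type u} [Ring A] [Algebra k⟦X⟧ A] (d : ℕ → A) :
    hSumHat k d = hSum k fun n => toHComp k (d n) := by
  refine sub_eq_zero.1 (eq_zero_of_family (k := k)
    (fun d : ℕ → A => hSumHat k d - hSum k fun n => toHComp k (d n)) (fun d => ?_) d)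
  refine ⟨fun n => d (n + 1), 1, ?_⟩
  rw [hSumHat_eq d, hSum_eq fun n => toHComp k (d n), one_mul, smul_sub]
  abel

/-- The series in the completion of an arbitrary algebra is a value of the functional calculus of
the completion. -/
theorem hSeries_eq_hEval {A : Type u} [Ring A] [Algebra k⟦X⟧ A] (f : k⟦X⟧) (x : A) :
    hSeries f x = hEval (toHComp k x) f := by
  have h : hSeries f x = hSumHat k fun n => PowerSeries.C (coeff n f) • x ^ n := by
    ext N
    simp only [hSeries, hSumHat, smul_smul, mul_comm]
  rw [h, hSumHat_eq_hSum]
  simp [hEval]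

theorem hSeriesDiv_eq_hEvalDiv {A : Type u} [Ring A] [Algebra k⟦X⟧ A] (f : k⟦X⟧) (x : A) :
    hSeriesDiv f x = hEvalDiv (toHComp k x) f := by
  have h : hSeriesDiv f x = hSumHat k fun n => PowerSeries.C (coeff (n + 1) f) • x ^ (n + 1) := by
    ext N
    simp only [hSeriesDiv, hSumHat, smul_smul, mul_comm]
  rw [h, hSumHat_eq_hSum, hEvalDiv_eq_hSum]
  simp

theorem hEval_smul (c : k) (x : C) (f : k⟦X⟧) :
    hEval (PowerSeries.C c • x) f = hEval x (PowerSeries.rescale c f) := by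
  simp [hEval, smul_pow, smul_smul, mul_comm]

theorem hEval_neg (x : C) (f : k⟦X⟧) :
    hEval (-x) f = hEval x (PowerSeries.rescale (-1) f) := by
  rw [← hEval_smul]; simp

/-! ### Composition of series -/

theorem subst_eq_tail {ℓ : k⟦X⟧} (hℓ : constantCoeff ℓ = 0) (g : k⟦X⟧) :
    g.subst ℓ = PowerSeries.C (constantCoeff g) + ℓ * (tail g).subst ℓ := by
  have hs : PowerSeries.HasSubst ℓ := PowerSeries.HasSubst.of_constantCoeff_zero' hℓ
  conv_lhs => rw [eq_C_add_X_mul_tail g]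
  rw [PowerSeries.subst_add hs, PowerSeries.subst_mul hs, PowerSeries.subst_X hs,
    PowerSeries.subst_C]
  rfl

/-- Composition: `g(ℓ(h x)) = g(h y)` for `y = ℓ(h x) / h`. -/
theorem hEval_subst {ℓ : k⟦X⟧} (hℓ : constantCoeff ℓ = 0) (x : C) (g : k⟦X⟧) :
    hEval x (g.subst ℓ) = hEval (hEvalDiv x ℓ) g := by
  refine sub_eq_zero.1 (eq_zero_of_family (k := k) (fun g : k⟦X⟧ =>
    hEval x (g.subst ℓ) - hEval (hEvalDiv x ℓ) g) (fun g => ⟨tail g, hEvalDiv x ℓ, ?_⟩) g)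
  rw [subst_eq_tail hℓ g, hEval_eq_tail _ g, map_add, map_mul, hEval_C, hEval_eq x ℓ, hℓ]
  simp only [map_zero, zero_smul, zero_add, smul_mul_assoc, mul_sub, smul_sub]
  abel

theorem hEvalDiv_subst {ℓ : k⟦X⟧} (hℓ : constantCoeff ℓ = 0) (x : C) (g : k⟦X⟧) :
    hEvalDiv x (g.subst ℓ) = hEvalDiv (hEvalDiv x ℓ) g := by
  rw [subst_eq_tail hℓ g, map_add, hEvalDiv_C, zero_add, hEvalDiv_mul, hℓ, hEval_subst hℓ,
    hEvalDiv_apply (hEvalDiv x ℓ) g]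
  simp

/-! ### Commutation rules -/

/-- An intertwining relation `x w = w y` extends to power series. -/
theorem hEval_mul_of_mul_eq {x y w : C} (h : x * w = w * y) (f : k⟦X⟧) :
    hEval x f * w = w * hEval y f := by
  refine sub_eq_zero.1 (eq_zero_of_family (k := k)
    (fun f : k⟦X⟧ => hEval x f * w - w * hEval y f) (fun f => ⟨tail f, x, ?_⟩) f)
  rw [hEval_eq_tail x f, hEval_eq_tail y f]
  simp only [add_mul, mul_add, smul_mul_assoc, mul_smul_comm, one_mul, mul_one, mul_sub, smul_sub,
    ← mul_assoc, ← h]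
  abel

theorem hEval_commute {x w : C} (h : Commute x w) (f : k⟦X⟧) : Commute (hEval x f) w :=
  hEval_mul_of_mul_eq h f

theorem hEvalDiv_commute {x w : C} (h : Commute x w) (f : k⟦X⟧) : Commute (hEvalDiv x f) w :=
  h.mul_left (hEval_commute h _)

/-- The commutator with `x` acts on `f(h x)` as a derivation. -/
theorem commutator_hEval {a x s : C} (hs : a * x - x * a = s) (hc : Commute x s) (f : k⟦X⟧) :
    a * hEval x f - hEval x f * a = hbar k • (hEval x (derivative k f) * s) := by
  refine sub_eq_zero.1 (eq_zero_of_family (k := k) (fun f : k⟦X⟧ => a * hEval x f - hEval x f * a -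
    hbar k • (hEval x (derivative k f) * s)) (fun f => ⟨tail f, x, ?_⟩) f)
  have hax : a * x = x * a + s := by rw [← hs]; abel
  rw [derivative_eq_tail f, hEval_eq_tail x f, map_add, map_mul, hEval_X]
  have h := (hEval_commute hc (tail f)).eq
  simp only [add_mul, mul_add, smul_mul_assoc, mul_smul_comm, one_mul, mul_one, mul_sub, smul_sub,
    ← mul_assoc, hax, h, smul_add]
  simp only [mul_assoc]
  abel

theorem commutator_hEvalDiv {a x s : C} (hs : a * x - x * a = s) (hc : Commute x s) (f : k⟦X⟧) :
    a * hEvalDiv x f - hEvalDiv x f * a = hEval x (derivative k f) * s := by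
  have h1 := commutator_hEval hs hc (tail f)
  have h := (hEval_commute hc (tail f)).eq
  have hax : a * x = x * a + s := by rw [← hs]; abel
  rw [derivative_eq_tail f, hEvalDiv_apply, map_add, map_mul, hEval_X, ← mul_assoc, hax, add_mul,
    add_mul, h, smul_mul_assoc, smul_mul_assoc, mul_assoc x _ s, ← mul_smul_comm, ← h1, mul_sub]
  simp only [mul_assoc]
  abel

variable [CharZero k]

theorem half_add_half_smul {C : Type u} [Ring C] [Algebra k⟦X⟧ C] (y : C) :
    PowerSeries.C (1 / 2 : k) • y + PowerSeries.C (1 / 2 : k) • y = y := by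
  rw [← add_smul, ← map_add]; norm_num

/-- The commutator `[f(h x), w]` when `c = [x, w]` does not commute with `x` but `s = [c, x]`
does: there is a correction by the second derivative of `f`. -/
theorem hEval_commutator {x w c s : C} (hw : x * w - w * x = c) (hs : c * x - x * c = s)
    (hc : Commute x s) (f : k⟦X⟧) :
    hEval x f * w - w * hEval x f = hbar k • (hEval x (derivative k f) * c +
      hbar k • PowerSeries.C (1 / 2 : k) • (hEval x (derivative k (derivative k f)) * s)) := by
  refine sub_eq_zero.1 (eq_zero_of_family (k := k) (fun f : k⟦X⟧ =>
    hEval x f * w - w * hEval x f - hbar k • (hEval x (derivative k f) * c + hbar k •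
      PowerSeries.C (1 / 2 : k) • (hEval x (derivative k (derivative k f)) * s)))
    (fun f => ⟨tail f, x, ?_⟩) f)
  have hwx : w * x = x * w - c := by rw [← hw]; abel
  have h1 := commutator_hEval hs hc (tail f)
  have h2 := half_add_half_smul (k := k) (hEval x (derivative k (tail f)) * s)
  rw [derivative_derivative_eq_tail f, derivative_eq_tail f, hEval_eq_tail x f]
  have h3 : c * hEval x (tail f) = hEval x (tail f) * c +
    hbar k • (hEval x (derivative k (tail f)) * s) := by rw [← h1]; abel
  rw [← h2] at h3
  simp only [add_mul, mul_add, smul_mul_assoc, mul_smul_comm, one_mul, mul_one, mul_sub, smul_sub,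
    ← mul_assoc, hwx, smul_add, map_add, map_mul, hEval_X, two_mul, sub_mul, h3]
  simp only [mul_assoc, smul_comm (PowerSeries.C (1 / 2 : k)) (hbar k)]
  abel

theorem hEvalDiv_commutator {x w c s : C} (hw : x * w - w * x = c) (hs : c * x - x * c = s)
    (hc : Commute x s) (f : k⟦X⟧) :
    hEvalDiv x f * w - w * hEvalDiv x f = hEval x (derivative k f) * c +
      hbar k • PowerSeries.C (1 / 2 : k) • (hEval x (derivative k (derivative k f)) * s) := by
  have hwx : w * x = x * w - c := by rw [← hw]; abel
  have h0 := hEval_commutator hw hs hc (tail f)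
  have h0' : hEval x (tail f) * w = w * hEval x (tail f) + hbar k •
      (hEval x (derivative k (tail f)) * c + hbar k • PowerSeries.C (1 / 2 : k) •
        (hEval x (derivative k (derivative k (tail f))) * s)) := by rw [← h0]; abel
  have h1 := commutator_hEval hs hc (tail f)
  have h2 := half_add_half_smul (k := k) (hEval x (derivative k (tail f)) * s)
  have h3 : c * hEval x (tail f) = hEval x (tail f) * c +
    hbar k • (hEval x (derivative k (tail f)) * s) := by rw [← h1]; abel
  rw [← h2] at h3
  rw [derivative_derivative_eq_tail f, derivative_eq_tail f, hEvalDiv_apply]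
  rw [mul_assoc x, h0']
  simp only [add_mul, mul_add, smul_mul_assoc, mul_smul_comm,
    ← mul_assoc, hwx, smul_add, map_add, map_mul, hEval_X, two_mul, sub_mul, h3]
  simp only [mul_assoc, smul_comm (PowerSeries.C (1 / 2 : k)) (hbar k)]
  abel

/-! ### Exponentials of sums -/

/-- The binomial theorem for commuting elements, for the coefficients of `e^{at}`. -/
theorem coeff_exp_mul_add_pow {C : Type u} [Ring C] [Algebra k⟦X⟧ C] {x y : C} (h : Commute x y) (a : k) (n : ℕ) :
    PowerSeries.C (coeff n (PowerSeries.rescale a (PowerSeries.exp k))) • (x + y) ^ n =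
      ∑ p ∈ Finset.HasAntidiagonal.antidiagonal n,
        (PowerSeries.C (coeff p.1 (PowerSeries.rescale a (PowerSeries.exp k))) • x ^ p.1) *
        (PowerSeries.C (coeff p.2 (PowerSeries.rescale a (PowerSeries.exp k))) • y ^ p.2) := by
  rw [h.add_pow', Finset.smul_sum]
  refine Finset.sum_congr rfl fun p hp => ?_
  obtain rfl := Finset.HasAntidiagonal.mem_antidiagonal.1 hp
  rw [smul_mul_smul_comm, ← map_mul, ← Nat.cast_smul_eq_nsmul k⟦X⟧, smul_smul]
  congr 1
  rw [← map_natCast (PowerSeries.C (R := k)), ← map_mul]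
  congr 1
  simp only [PowerSeries.coeff_rescale, PowerSeries.coeff_exp, map_div₀, map_one, map_natCast]
  have h1 : ((p.1 + p.2).factorial : k) =
      ((p.1 + p.2).choose p.1 : k) * (p.1.factorial : k) * (p.2.factorial : k) := by
    have := Nat.choose_mul_factorial_mul_factorial (Nat.le_add_right p.1 p.2)
    rw [Nat.add_sub_cancel_left] at this
    exact_mod_cast this.symm
  have e1 : (p.1.factorial : k) ≠ 0 := Nat.cast_ne_zero.2 (Nat.factorial_ne_zero _)
  have e2 : (p.2.factorial : k) ≠ 0 := Nat.cast_ne_zero.2 (Nat.factorial_ne_zero _)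
  have e3 : ((p.1 + p.2).choose p.1 : k) ≠ 0 :=
    Nat.cast_ne_zero.2 (Nat.choose_pos (Nat.le_add_right _ _)).ne'
  rw [h1, pow_add]
  field_simp

/-- The addition formula of the exponential, divided by `h`. -/
theorem hEvalDiv_rescale_exp_add {x y : C} (h : Commute x y) (a : k) :
    hEvalDiv (x + y) (PowerSeries.rescale a (PowerSeries.exp k)) =
      hEvalDiv x (PowerSeries.rescale a (PowerSeries.exp k)) *
        hEval y (PowerSeries.rescale a (PowerSeries.exp k)) +
      hEvalDiv y (PowerSeries.rescale a (PowerSeries.exp k)) := by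
  rw [hEvalDiv_eq_hSum, hEvalDiv_eq_hSum x, hEvalDiv_eq_hSum y]
  change _ = _ * hSum k _ + _
  rw [hSum_mul, ← hSum_add]
  congr 1
  ext n
  rw [coeff_exp_mul_add_pow h, Finset.Nat.sum_antidiagonal_succ, add_comm]
  simp

theorem hEval_rescale_exp_add {x y : C} (h : Commute x y) (a : k) :
    hEval (x + y) (PowerSeries.rescale a (PowerSeries.exp k)) =
      hEval x (PowerSeries.rescale a (PowerSeries.exp k)) *
        hEval y (PowerSeries.rescale a (PowerSeries.exp k)) := by
  have h0 : constantCoeff (PowerSeries.rescale a (PowerSeries.exp k)) = 1 := by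
    rw [← PowerSeries.coeff_zero_eq_constantCoeff_apply]; simp
  rw [hEval_eq, hEvalDiv_rescale_exp_add h, hEval_eq x, add_mul, smul_mul_assoc, smul_add,
    smul_mul_assoc, one_mul, h0, hEval_eq y, h0]
  simp
  abel

theorem hEval_exp_add {x y : C} (h : Commute x y) :
    hEval (x + y) (PowerSeries.exp k) =
      hEval x (PowerSeries.exp k) * hEval y (PowerSeries.exp k) := by
  simpa using hEval_rescale_exp_add h (1 : k)

theorem hEval_exp_mul_neg (x : C) :
    hEval x (PowerSeries.exp k) * hEval (-x) (PowerSeries.exp k) = 1 := by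
  rw [hEval_neg, ← map_mul]
  have h := PowerSeries.exp_mul_exp_neg_eq_one (A := k)
  rw [PowerSeries.evalNegHom] at h
  rw [h, map_one]

theorem hEval_exp_neg_mul (x : C) :
    hEval (-x) (PowerSeries.exp k) * hEval x (PowerSeries.exp k) = 1 := by
  simpa using hEval_exp_mul_neg (-x)

end Calculus

/-! ### The series relating `X` and `J₊` -/

section Series

open PowerSeries (coeff constantCoeff derivative)

variable (k : Type u) [Field k] [CharZero k]

/-- The scalar `h / 8`. The coefficients `h`, `h / 2` and `h / 8` are integer multiples of it, so
that identities over an arbitrary commutative ring apply. -/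
def eta : k⟦X⟧ := PowerSeries.C (1 / 8) * hbar k

theorem hbar_eq : hbar k = 8 * eta k := by
  have h : (8 : k⟦X⟧) = PowerSeries.C 8 := (map_ofNat PowerSeries.C 8).symm
  rw [eta, ← mul_assoc, h, ← map_mul]; norm_num

theorem half_mul_hbar : PowerSeries.C (1 / 2 : k) * hbar k = 4 * eta k := by
  have h : (4 : k⟦X⟧) = PowerSeries.C 4 := (map_ofNat PowerSeries.C 4).symm
  rw [eta, ← mul_assoc, h, ← map_mul]; norm_num

theorem two_mul_half : (2 : k⟦X⟧) * PowerSeries.C (1 / 2) = 1 := by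
  have h : (2 : k⟦X⟧) = PowerSeries.C 2 := (map_ofNat PowerSeries.C 2).symm
  rw [h, ← map_mul]; norm_num

/-- The series `(1 - e^{-2t}) / 2`, which expresses `h J₊` by `h X`. -/
def plusSeries : k⟦X⟧ :=
  PowerSeries.C (1 / 2) * (1 - PowerSeries.rescale (-2) (PowerSeries.exp k))

theorem derivative_rescale_exp (a : k) :
    derivative k (PowerSeries.rescale a (PowerSeries.exp k)) =
      PowerSeries.C a * PowerSeries.rescale a (PowerSeries.exp k) := by
  ext n
  have h := congrArg (coeff n) (PowerSeries.derivative_exp k)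
  rw [PowerSeries.coeff_derivative] at h
  rw [PowerSeries.coeff_derivative, PowerSeries.coeff_C_mul, PowerSeries.coeff_rescale,
    PowerSeries.coeff_rescale, ← h]
  ring

theorem derivative_derivative_rescale_exp (a : k) :
    derivative k (derivative k (PowerSeries.rescale a (PowerSeries.exp k))) =
      PowerSeries.C (a * a) * PowerSeries.rescale a (PowerSeries.exp k) := by
  rw [derivative_rescale_exp, Derivation.leibniz, derivative_rescale_exp]
  simp only [PowerSeries.derivative_C, smul_eq_mul, mul_zero, add_zero, map_mul, mul_assoc]

theorem constantCoeff_rescale_exp (a : k) :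
    constantCoeff (PowerSeries.rescale a (PowerSeries.exp k)) = 1 := by
  rw [← PowerSeries.coeff_zero_eq_constantCoeff_apply]; simp

theorem derivative_plusSeries :
    derivative k (plusSeries k) = PowerSeries.rescale (-2) (PowerSeries.exp k) := by
  rw [plusSeries, Derivation.leibniz, map_sub, derivative_rescale_exp]
  simp only [PowerSeries.derivative_C, smul_eq_mul,
    Derivation.map_one_eq_zero, zero_sub, mul_neg, ← mul_assoc, ← map_mul, ← map_neg, ← neg_mul]
  norm_num

theorem constantCoeff_plusSeries : constantCoeff (plusSeries k) = 0 := by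
  rw [plusSeries, map_mul, map_sub, constantCoeff_rescale_exp]; simp

theorem isUnit_coeff_one_plusSeries : IsUnit (coeff 1 (plusSeries k)) := by
  have h := congrArg (coeff 0) (derivative_plusSeries k)
  rw [PowerSeries.coeff_derivative] at h
  simp at h
  simp [h]

/-- The compositional inverse of `plusSeries`, that is `-log (1 - 2t) / 2`. -/
def logSeries : k⟦X⟧ :=
  (plusSeries k).substInvOfIsUnit (isUnit_coeff_one_plusSeries k)

theorem constantCoeff_logSeries : constantCoeff (logSeries k) = 0 :=
  PowerSeries.constantCoeff_substInvOfIsUnit _ _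

theorem plusSeries_subst : (plusSeries k).subst (logSeries k) = PowerSeries.X :=
  PowerSeries.subst_substInvOfIsUnit_right _ (constantCoeff_plusSeries k) _

theorem logSeries_subst : (logSeries k).subst (plusSeries k) = PowerSeries.X :=
  PowerSeries.subst_substInvOfIsUnit_left _ (constantCoeff_plusSeries k) _

theorem rescale_exp_mul_rescale_exp (a b : k) :
    PowerSeries.rescale a (PowerSeries.exp k) * PowerSeries.rescale b (PowerSeries.exp k) =
      PowerSeries.rescale (a + b) (PowerSeries.exp k) :=
  PowerSeries.exp_mul_exp_eq_exp_add a b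

/-- If `e^{-2t} g(t) = f(t)` then `g(t) = e^{2t} f(t)`. -/
theorem eq_of_mul_rescale_exp_neg {g f : k⟦X⟧}
    (h : g * PowerSeries.rescale (-2) (PowerSeries.exp k) = f) :
    g = PowerSeries.rescale 2 (PowerSeries.exp k) * f := by
  rw [← h, mul_left_comm, rescale_exp_mul_rescale_exp]
  simp

/-- The derivative `1 / (1 - 2t)` of the logarithm, at `t = plusSeries`. -/
theorem derivative_logSeries_subst :
    (derivative k (logSeries k)).subst (plusSeries k) =
      PowerSeries.rescale 2 (PowerSeries.exp k) := by
  have hs := PowerSeries.HasSubst.of_constantCoeff_zero' (constantCoeff_plusSeries k)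
  have h := PowerSeries.derivative_subst (f := logSeries k) hs
  rw [logSeries_subst, derivative_plusSeries, PowerSeries.derivative_X] at h
  simpa using eq_of_mul_rescale_exp_neg k h.symm

theorem derivative_derivative_logSeries_subst :
    (derivative k (derivative k (logSeries k))).subst (plusSeries k) =
      PowerSeries.C 2 * PowerSeries.rescale 4 (PowerSeries.exp k) := by
  have hs := PowerSeries.HasSubst.of_constantCoeff_zero' (constantCoeff_plusSeries k)
  have h := PowerSeries.derivative_subst (f := derivative k (logSeries k)) hs
  rw [derivative_logSeries_subst, derivative_plusSeries, derivative_rescale_exp] at h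
  rw [eq_of_mul_rescale_exp_neg k h.symm, mul_left_comm, rescale_exp_mul_rescale_exp]
  norm_num

end Series

/-! ### The Jordanian and the classical relations in a complete algebra -/

section Triples

open PowerSeries (coeff constantCoeff derivative)

variable (k : Type u) [Field k] [CharZero k] {C : Type u} [Ring C] [Algebra k⟦X⟧ C]
  [HComplete k C]

/-- The exponential `e^{h x}` in a complete algebra. -/
def expH (x : C) : C := hEval x (PowerSeries.exp k)

theorem expH_mul_neg (x : C) : expH k x * expH k (-x) = 1 := hEval_exp_mul_neg x

theorem expH_neg_mul (x : C) : expH k (-x) * expH k x = 1 := hEval_exp_neg_mul x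

theorem expH_commute {x w : C} (h : Commute x w) : Commute (expH k x) w := hEval_commute h _

theorem hEval_rescale_exp (a : k) (x : C) :
    hEval x (PowerSeries.rescale a (PowerSeries.exp k)) = expH k (PowerSeries.C a • x) :=
  (hEval_smul a x _).symm

theorem expH_add {x y : C} (h : Commute x y) : expH k (x + y) = expH k x * expH k y :=
  hEval_exp_add h

theorem hEval_rescale_neg_one (x : C) :
    hEval x (PowerSeries.rescale (-1) (PowerSeries.exp k)) = expH k (-x) := (hEval_neg x _).symm

theorem hEval_rescale_two (x : C) :
    hEval x (PowerSeries.rescale 2 (PowerSeries.exp k)) = expH k x * expH k x := by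
  have h := rescale_exp_mul_rescale_exp k 1 1
  rw [one_add_one_eq_two] at h
  rw [← h, map_mul]
  simp [expH]

theorem hEval_rescale_four (x : C) :
    hEval x (PowerSeries.rescale 4 (PowerSeries.exp k)) =
      expH k x * expH k x * (expH k x * expH k x) := by
  have h := rescale_exp_mul_rescale_exp k 2 2
  rw [show (2 : k) + 2 = 4 by norm_num] at h
  rw [← h, map_mul, hEval_rescale_two]

theorem hEval_rescale_neg_two (x : C) :
    hEval x (PowerSeries.rescale (-2) (PowerSeries.exp k)) = expH k (-x) * expH k (-x) := by
  have h := rescale_exp_mul_rescale_exp k (-1) (-1)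
  rw [show (-1 : k) + -1 = -2 by norm_num] at h
  rw [← h, map_mul, hEval_rescale_neg_one]

/-- The defining relations of the Jordanian algebra for three elements of a complete algebra. -/
structure JTriple (X H Y : C) : Prop where
  HX : H * X - X * H = hEvalDiv X (twoSinh k)
  HY : H * Y - Y * H = -(Y * hEval X (coshSeries k)) - hEval X (coshSeries k) * Y
  XY : X * Y - Y * X = H

/-- The relations of `sl(2)` for three elements `P, Z, M` (raising, diagonal, lowering). -/
structure SlTriple (P Z M : C) : Prop where
  ZP : Z * P - P * Z = (2 : k⟦X⟧) • P
  ZM : Z * M - M * Z = (-2 : k⟦X⟧) • M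
  PM : P * M - M * P = Z

/-- `J₊` in terms of `X`. -/
def plusOf (X : C) : C := hEvalDiv X (plusSeries k)

/-- `J₋` in terms of `X, H, Y`. -/
def minusOf (X H Y : C) : C :=
  expH k X * Y - (PowerSeries.C (1 / 2) * hbar k) • (expH k X * H) ^ 2
    - (PowerSeries.C (1 / 8) * hbar k) • (expH k X ^ 2 - 1)

/-- `X` in terms of `J₊`. -/
def xOf (P : C) : C := hEvalDiv P (logSeries k)

/-- `H` in terms of `J₊, J₀`. -/
def hOf (P Z : C) : C := expH k (-xOf k P) * Z

/-- `Y` in terms of `J₊, J₀, J₋`. -/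
def yOf (P Z M : C) : C :=
  expH k (-xOf k P) * (M + (PowerSeries.C (1 / 2) * hbar k) • Z ^ 2
    + (PowerSeries.C (1 / 8) * hbar k) • (expH k (xOf k P) ^ 2 - 1))

theorem xOf_plusOf (X : C) : xOf k (plusOf k X) = X := by
  rw [xOf, plusOf, ← hEvalDiv_subst (constantCoeff_plusSeries k), logSeries_subst, hEvalDiv_X]

theorem plusOf_xOf (P : C) : plusOf k (xOf k P) = P := by
  rw [xOf, plusOf, ← hEvalDiv_subst (constantCoeff_logSeries k), plusSeries_subst, hEvalDiv_X]

theorem hOf_mul (X H : C) : hOf k (plusOf k X) (expH k X * H) = H := by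
  rw [hOf, xOf_plusOf, ← mul_assoc, expH_neg_mul, one_mul]

theorem yOf_minusOf (X H Y : C) :
    yOf k (plusOf k X) (expH k X * H) (minusOf k X H Y) = Y := by
  rw [yOf, xOf_plusOf, minusOf, sub_add_eq_add_sub, sub_add_cancel, sub_add_cancel, ← mul_assoc,
    expH_neg_mul, one_mul]

theorem mul_hOf (P Z : C) : expH k (xOf k P) * hOf k P Z = Z := by
  rw [hOf, ← mul_assoc, expH_mul_neg, one_mul]

theorem minusOf_yOf (P Z M : C) :
    minusOf k (xOf k P) (hOf k P Z) (yOf k P Z M) = M := by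
  rw [minusOf, mul_hOf, yOf, ← mul_assoc, expH_mul_neg, one_mul]
  abel

end Triples

/-! ### From the Jordanian relations to those of `sl(2)` -/

section Algebra

variable {R : Type*} [CommRing R] {C : Type*} [Ring C] [Algebra R C]

/-- The form of `a * b = c` that rewrites inside right-associated products. -/
theorem reassoc {a b c : C} (h : a * b = c) (z : C) : a * (b * z) = c * z := by
  rw [← mul_assoc, h]

/-- Modulo the relations for `[H, X]` and `[X, Y]`, which enter through the commutators of `T` with
`H` and of `T`, `U = T⁻¹` with `Y`, the relation `[J₀, J₋] = -2 J₋` is `T²` times the relation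
`[H, Y] = -Y c - c Y`, where `c = cosh (h X)`. -/
theorem zm_identity {T U H Y c : C} (η half : R) (hhalf : 2 * half = 1) (TU : T * U = 1)
    (hc : c = half • (T + U)) (HT : H * T = T * H + T * T - 1)
    (YT : Y * T = T * Y - (8 * η) • (T * H) - (4 * η) • (T * T - 1))
    (YU : Y * U = U * Y + (8 * η) • (U * H) - (4 * η) • (1 - U * U)) :
    (T * H) * (T * Y - (4 * η) • (T * H) ^ 2 - η • (T ^ 2 - 1))
      - (T * Y - (4 * η) • (T * H) ^ 2 - η • (T ^ 2 - 1)) * (T * H)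
      + (2 : R) • (T * Y - (4 * η) • (T * H) ^ 2 - η • (T ^ 2 - 1)) =
    T * T * (H * Y - Y * H + Y * c + c * Y) := by
  have h1 : Y * c + c * Y = T * Y + U * Y - (4 * η) • (T * H) - (2 * η) • (T * T - 1)
      + (4 * η) • (U * H) - (2 * η) • (1 - U * U) := by
    have h2 : Y * c + c * Y = half • (2 : R) • (T * Y + U * Y - (4 * η) • (T * H)
        - (2 * η) • (T * T - 1) + (4 * η) • (U * H) - (2 * η) • (1 - U * U)) := by
      rw [hc, mul_smul_comm, smul_mul_assoc, ← smul_add, mul_add, add_mul, YT, YU]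
      congr 1
      module
    rw [h2, smul_smul, mul_comm half, hhalf, one_smul]
  rw [add_assoc _ (Y * c), h1]
  simp only [mul_add, add_mul, mul_sub, sub_mul, mul_assoc, smul_mul_assoc, mul_smul_comm,
    smul_add, smul_sub, pow_two, one_mul, mul_one, HT, reassoc HT, reassoc YT, TU, reassoc TU]
  module

/-- The relation `[J₀, J₊] = 2 J₊`, with `P = J₊`, `U = T⁻¹` and `s = [H, X]`. -/
theorem zp_identity {T U H P s : C} (TU : T * U = 1) (TP : Commute T P)
    (HP : H * P - P * H = U * U * s) (Us : U * s = (2 : R) • P) :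
    (T * H) * P - P * (T * H) = (2 : R) • P := by
  rw [← mul_assoc P, ← TP.eq, mul_assoc, mul_assoc, ← mul_sub, HP, mul_assoc, reassoc TU, one_mul,
    Us]

/-- The relation `[J₊, J₋] = J₀`, with `P = J₊`, `U = T⁻¹` and `16 η = 2 h`. -/
theorem pm_identity {T U H Y P : C} (η : R) (TU : T * U = 1) (UT : U * T = 1) (TP : Commute T P)
    (hP : (16 * η) • P = 1 - U * U) (ZP : (T * H) * P - P * (T * H) = (2 : R) • P)
    (PY : P * Y - Y * P = U * U * H - (16 * η) • (U * P)) :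
    P * (T * Y - (4 * η) • (T * H) ^ 2 - η • (T ^ 2 - 1))
      - (T * Y - (4 * η) • (T * H) ^ 2 - η • (T ^ 2 - 1)) * P = T * H := by
  -- In terms of `Z = J₀` only the commutation rule for `Z` and `P` is needed.
  obtain ⟨Z, hZ⟩ : ∃ Z, Z = T * H := ⟨_, rfl⟩
  have hH : H = U * Z := by rw [hZ, reassoc UT, one_mul]
  rw [← hZ] at ZP ⊢
  rw [hH] at PY
  have ZP' : Z * P = P * Z + (2 : R) • P := by rw [← ZP]; abel
  have PY' : P * Y = Y * P + (U * U * (U * Z) - (16 * η) • (U * P)) := by rw [← PY]; abel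
  have e1 : P * (T * Y) - T * Y * P = U * U * Z - 1 + U * U := by
    rw [← mul_assoc P, ← TP.eq, mul_assoc, PY']
    simp only [mul_add, mul_sub, mul_assoc, mul_smul_comm, reassoc TU, one_mul, hP]
    abel
  have e2 : (4 * η) • (P * Z ^ 2 - Z ^ 2 * P) = -((1 - U * U) * Z + (1 - U * U)) := by
    rw [← hP, pow_two]
    simp only [mul_assoc, ZP', reassoc ZP', mul_add, add_mul, smul_mul_assoc, mul_smul_comm]
    module
  have e3 : P * T ^ 2 = T ^ 2 * P := (TP.symm.pow_right 2).eq
  simp only [mul_sub, sub_mul, mul_smul_comm, smul_mul_assoc, mul_one, one_mul, e3]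
  rw [smul_sub] at e2
  have : P * (T * Y) - (4 * η) • (P * Z ^ 2) - η • (T ^ 2 * P - P) -
      (T * Y * P - (4 * η) • (Z ^ 2 * P) - η • (T ^ 2 * P - P)) =
      (P * (T * Y) - T * Y * P) - ((4 * η) • (P * Z ^ 2) - (4 * η) • (Z ^ 2 * P)) := by abel
  rw [this, e1, e2, sub_mul, one_mul]
  abel

end Algebra

section Triples

open PowerSeries (coeff constantCoeff derivative)

variable {k : Type u} [Field k] [CharZero k] {C : Type u} [Ring C] [Algebra k⟦X⟧ C]
  [HComplete k C]

/-- The identity `(e^t - e^{-t}) e^{-t} = 1 - e^{-2t}`. -/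
theorem twoSinh_mul : twoSinh k * PowerSeries.rescale (-1) (PowerSeries.exp k) =
    PowerSeries.C 2 * plusSeries k := by
  have h1 := rescale_exp_mul_rescale_exp k 1 (-1)
  have h2 := rescale_exp_mul_rescale_exp k (-1) (-1)
  rw [show (-1 : k) + -1 = -2 by norm_num] at h2
  simp only [PowerSeries.rescale_one, RingHom.id_apply, add_neg_cancel,
    PowerSeries.rescale_zero_apply, PowerSeries.constantCoeff_exp, map_one] at h1
  rw [twoSinh, sub_mul, h1, h2, plusSeries, ← mul_assoc, ← map_mul]
  norm_num

theorem constantCoeff_twoSinh : constantCoeff (twoSinh k) = 0 := by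
  rw [twoSinh, map_sub, constantCoeff_rescale_exp]; simp

theorem two_smul_plusOf (X : C) :
    hEvalDiv X (twoSinh k) * expH k (-X) = (2 : k⟦X⟧) • plusOf k X := by
  have h := hEvalDiv_mul X (twoSinh k) (PowerSeries.rescale (-1) (PowerSeries.exp k))
  rw [twoSinh_mul, hEvalDiv_C_mul, constantCoeff_twoSinh, hEval_rescale_neg_one,
    map_ofNat] at h
  rw [plusOf, h]
  simp

theorem hbar_smul_twoSinh (X : C) :
    hbar k • hEvalDiv X (twoSinh k) = expH k X - expH k (-X) := by
  have h := hEval_eq X (twoSinh k)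
  rw [constantCoeff_twoSinh, map_zero, zero_smul, zero_add] at h
  rw [← h, twoSinh, map_sub, hEval_rescale_neg_one]
  rfl

theorem hbar_smul_plusOf (X : C) :
    (2 * hbar k) • plusOf k X = 1 - expH k (-X) * expH k (-X) := by
  have h := hEval_eq X (plusSeries k)
  rw [constantCoeff_plusSeries, map_zero, zero_smul, zero_add] at h
  rw [mul_smul, plusOf, ← h, plusSeries, hEval_C_mul, smul_smul, two_mul_half, one_smul, map_sub,
    map_one, hEval_rescale_neg_two]

theorem sinh_commute (X : C) : Commute X (hEvalDiv X (twoSinh k)) :=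
  (hEvalDiv_commute (Commute.refl X) _).symm

theorem exp_mul_sinh (X : C) :
    hbar k • (expH k X * hEvalDiv X (twoSinh k)) = expH k X * expH k X - 1 := by
  rw [← mul_smul_comm, hbar_smul_twoSinh, mul_sub, expH_mul_neg]

/-- `[H, T] = T² - 1`. -/
theorem mul_expH {X H : C} (HX : H * X - X * H = hEvalDiv X (twoSinh k)) :
    H * expH k X = expH k X * H + expH k X * expH k X - 1 := by
  have h := commutator_hEval HX (sinh_commute X) (PowerSeries.exp k)
  rw [PowerSeries.derivative_exp] at h
  have h2 := exp_mul_sinh (k := k) X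
  rw [expH] at h2 ⊢
  rw [add_sub_assoc, ← h2, ← h]
  abel

/-- The commutator with `Y` acts on functions of `X` as a derivation of second order. -/
theorem hEval_mul_y {X H Y : C} (HX : H * X - X * H = hEvalDiv X (twoSinh k))
    (XY : X * Y - Y * X = H) (f : k⟦X⟧) :
    hEval X f * Y = Y * hEval X f + (8 * eta k) • (hEval X (derivative k f) * H) +
      (4 * eta k) • (hEval X (derivative k (derivative k f)) * (expH k X - expH k (-X))) := by
  have h := hEval_commutator XY HX (sinh_commute X) f
  rw [smul_add, smul_comm (hbar k) (PowerSeries.C (1 / 2 : k)), ← mul_smul_comm (hbar k) _ (hEvalDiv X _),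
    hbar_smul_twoSinh, smul_smul, mul_comm (hbar k), half_mul_hbar, hbar_eq] at h
  rw [add_assoc, ← h]
  abel

theorem y_mul_expH {X H Y : C} (HX : H * X - X * H = hEvalDiv X (twoSinh k))
    (XY : X * Y - Y * X = H) :
    Y * expH k X = expH k X * Y - (8 * eta k) • (expH k X * H)
      - (4 * eta k) • (expH k X * expH k X - 1) := by
  have h := hEval_mul_y HX XY (PowerSeries.exp k)
  rw [PowerSeries.derivative_exp, PowerSeries.derivative_exp] at h
  change expH k X * Y = _ + _ • (expH k X * H) + _ • (expH k X * _) at h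
  rw [h, mul_sub, expH_mul_neg]
  abel

theorem y_mul_expH_neg {X H Y : C} (HX : H * X - X * H = hEvalDiv X (twoSinh k))
    (XY : X * Y - Y * X = H) :
    Y * expH k (-X) = expH k (-X) * Y + (8 * eta k) • (expH k (-X) * H)
      - (4 * eta k) • (1 - expH k (-X) * expH k (-X)) := by
  have h := hEval_mul_y HX XY (PowerSeries.rescale (-1) (PowerSeries.exp k))
  rw [derivative_derivative_rescale_exp, derivative_rescale_exp, hEval_C_mul, hEval_C_mul,
    hEval_rescale_neg_one, neg_mul_neg, one_mul, map_neg, map_one, one_smul, neg_smul, one_smul,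
    mul_sub, expH_neg_mul, neg_mul, smul_neg] at h
  rw [h]
  abel

theorem plusOf_mul_y {X H Y : C} (HX : H * X - X * H = hEvalDiv X (twoSinh k))
    (XY : X * Y - Y * X = H) :
    plusOf k X * Y - Y * plusOf k X = expH k (-X) * expH k (-X) * H -
      (16 * eta k) • (expH k (-X) * plusOf k X) := by
  have h := hEvalDiv_commutator XY HX (sinh_commute X) (plusSeries k)
  have hs := ((expH_commute k (sinh_commute X).neg_left).eq).trans (two_smul_plusOf (k := k) X)
  rw [derivative_plusSeries, derivative_rescale_exp, hEval_C_mul, hEval_rescale_neg_two,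
    smul_mul_assoc, mul_assoc _ _ (hEvalDiv X (twoSinh k)), hs, mul_smul_comm, map_neg, map_ofNat,
    smul_smul, smul_smul, mul_comm (hbar k), half_mul_hbar] at h
  rw [plusOf, h, smul_smul, sub_eq_add_neg, ← neg_smul]
  congr 2
  ring

theorem mul_plusOf {X H : C} (HX : H * X - X * H = hEvalDiv X (twoSinh k)) :
    H * plusOf k X - plusOf k X * H =
      expH k (-X) * expH k (-X) * hEvalDiv X (twoSinh k) := by
  have h := commutator_hEvalDiv HX (sinh_commute X) (plusSeries k)
  rwa [derivative_plusSeries, hEval_rescale_neg_two] at h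

theorem hEval_coshSeries (X : C) :
    hEval X (coshSeries k) = PowerSeries.C (1 / 2 : k) • (expH k X + expH k (-X)) := by
  rw [coshSeries, hEval_C_mul, map_add, hEval_rescale_neg_one]
  rfl

theorem minusOf_eq (X H Y : C) : minusOf k X H Y =
    expH k X * Y - (4 * eta k) • (expH k X * H) ^ 2 - eta k • (expH k X ^ 2 - 1) := by
  rw [minusOf, half_mul_hbar, eta]

theorem expH_commute_plusOf (X : C) : Commute (expH k X) (plusOf k X) :=
  expH_commute k (hEvalDiv_commute (Commute.refl X) _).symm

theorem smul_plusOf (X : C) : (16 * eta k) • plusOf k X = 1 - expH k (-X) * expH k (-X) := by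
  rw [← hbar_smul_plusOf, hbar_eq]
  congr 1
  ring

/-- The identity behind the equivalence of the relations for `[J₀, J₋]` and `[H, Y]`. -/
theorem zm_identity_of {X H Y : C} (HX : H * X - X * H = hEvalDiv X (twoSinh k))
    (XY : X * Y - Y * X = H) :
    (expH k X * H) * minusOf k X H Y - minusOf k X H Y * (expH k X * H) +
      (2 : k⟦X⟧) • minusOf k X H Y =
    expH k X * expH k X * (H * Y - Y * H + Y * hEval X (coshSeries k) +
      hEval X (coshSeries k) * Y) := by
  rw [minusOf_eq]
  exact zm_identity (eta k) (PowerSeries.C (1 / 2)) (two_mul_half k) (expH_mul_neg k X)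
    (hEval_coshSeries X) (mul_expH HX) (y_mul_expH HX XY) (y_mul_expH_neg HX XY)

/-- Jordanian generators `X, H, Y` give the `sl(2)` triple `J₊, J₀, J₋`. -/
theorem JTriple.slTriple {X H Y : C} (h : JTriple k X H Y) :
    SlTriple k (plusOf k X) (expH k X * H) (minusOf k X H Y) := by
  have hs := ((expH_commute k (sinh_commute X).neg_left).eq).trans (two_smul_plusOf (k := k) X)
  have ZP := zp_identity (expH_mul_neg k X) (expH_commute_plusOf X) (mul_plusOf h.HX) hs
  refine ⟨ZP, ?_, ?_⟩
  · have h1 := zm_identity_of h.HX h.XY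
    have h2 : H * Y - Y * H + Y * hEval X (coshSeries k) + hEval X (coshSeries k) * Y = 0 := by
      rw [h.HY]; abel
    rw [h2, mul_zero] at h1
    rw [neg_smul]
    exact eq_neg_of_add_eq_zero_left h1
  · rw [minusOf_eq]
    exact pm_identity (eta k) (expH_mul_neg k X) (expH_neg_mul k X) (expH_commute_plusOf X)
      (smul_plusOf X) ZP (plusOf_mul_y h.HX h.XY)

end Triples

/-! ### From the relations of `sl(2)` to the Jordanian ones -/

section Algebra

variable {R : Type*} [CommRing R] {C : Type*} [Ring C] [Algebra R C]

/-- The relation `[X, Y] = H` from the commutators of `X` with `Z = J₀` and `M = J₋`, where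
`H = U Z`, `U = T⁻¹` and `Y` is the displayed multiple of `U`. -/
theorem xy_identity {T U X Z M P : C} (η : R) (TU : T * U = 1)
    (UX : Commute U X) (TX : Commute T X)
    (hP : (16 * η) • P = 1 - U * U) (ZP : Z * P - P * Z = (2 : R) • P)
    (ZT : Z * T = T * Z + T * T * T - T)
    (ZX : Z * X - X * Z = T * T * ((2 : R) • P))
    (XM : X * M - M * X = T * T * Z + T * T * (T * T) - T * T) :
    X * (U * (M + (4 * η) • Z ^ 2 + η • (T ^ 2 - 1)))
      - U * (M + (4 * η) • Z ^ 2 + η • (T ^ 2 - 1)) * X = U * Z := by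
  have ZP' : Z * P = P * Z + (2 : R) • P := by rw [← ZP]; abel
  have ZX' : Z * X = X * Z + T * T * ((2 : R) • P) := by rw [← ZX]; abel
  have e1 : (4 * η) • (X * Z ^ 2 - Z ^ 2 * X) = -(T * T * ((16 * η) • P) * Z +
      T * T * (T * T) * ((16 * η) • P)) := by
    simp only [pow_two, mul_assoc, ZX', reassoc ZX', ZP', reassoc ZT, mul_add, add_mul, mul_sub, sub_mul, smul_mul_assoc, mul_smul_comm, smul_add,
      smul_sub]
    module
  have e2 : X * T ^ 2 = T ^ 2 * X := (TX.symm.pow_right 2).eq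
  have e3 : X * (M + (4 * η) • Z ^ 2 + η • (T ^ 2 - 1)) -
      (M + (4 * η) • Z ^ 2 + η • (T ^ 2 - 1)) * X =
      (X * M - M * X) + (4 * η) • (X * Z ^ 2 - Z ^ 2 * X) := by
    simp only [mul_add, add_mul, mul_sub, sub_mul, mul_smul_comm, smul_mul_assoc, e2, smul_sub,
      mul_one, one_mul]
    abel
  rw [← mul_assoc X, ← UX.eq, mul_assoc, mul_assoc, ← mul_sub, e3, XM, e1, hP]
  congr 1
  simp only [mul_sub, sub_mul, mul_assoc, mul_one, TU, reassoc TU, one_mul]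
  abel

end Algebra

section Triples

open PowerSeries (coeff constantCoeff derivative)

variable {k : Type u} [Field k] [CharZero k] {C : Type u} [Ring C] [Algebra k⟦X⟧ C]
  [HComplete k C]

theorem hEval_derivative_logSeries (P : C) :
    hEval P (derivative k (logSeries k)) = expH k (xOf k P) * expH k (xOf k P) := by
  conv_lhs => rw [← plusOf_xOf k P]
  rw [plusOf, ← hEval_subst (constantCoeff_plusSeries k), derivative_logSeries_subst,
    hEval_rescale_two]

theorem hEval_derivative_derivative_logSeries (P : C) :
    hEval P (derivative k (derivative k (logSeries k))) =
      (2 : k⟦X⟧) • (expH k (xOf k P) * expH k (xOf k P) *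
        (expH k (xOf k P) * expH k (xOf k P))) := by
  conv_lhs => rw [← plusOf_xOf k P]
  rw [plusOf, ← hEval_subst (constantCoeff_plusSeries k), derivative_derivative_logSeries_subst,
    hEval_C_mul, hEval_rescale_four, map_ofNat]

theorem smul_eq_one_sub (P : C) :
    (16 * eta k) • P = 1 - expH k (-xOf k P) * expH k (-xOf k P) := by
  have h := smul_plusOf (k := k) (xOf k P)
  rwa [plusOf_xOf] at h

theorem commute_xOf {P w : C} (h : Commute P w) : Commute (xOf k P) w := hEvalDiv_commute h _

/-- `[J₀, X] = 2 T² J₊`. -/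
theorem SlTriple.zx {P Z M : C} (h : SlTriple k P Z M) :
    Z * xOf k P - xOf k P * Z =
      expH k (xOf k P) * expH k (xOf k P) * ((2 : k⟦X⟧) • P) := by
  have h1 := commutator_hEvalDiv h.ZP ((Commute.refl P).smul_right _) (logSeries k)
  rwa [hEval_derivative_logSeries] at h1

/-- `[X, J₋] = T² J₀ + T⁴ - T²`. -/
theorem SlTriple.xm {P Z M : C} (h : SlTriple k P Z M) :
    xOf k P * M - M * xOf k P = expH k (xOf k P) * expH k (xOf k P) * Z +
      expH k (xOf k P) * expH k (xOf k P) * (expH k (xOf k P) * expH k (xOf k P)) -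
      expH k (xOf k P) * expH k (xOf k P) := by
  have h1 := hEvalDiv_commutator h.PM h.ZP ((Commute.refl P).smul_right _) (logSeries k)
  have h2 := smul_eq_one_sub (k := k) P
  rw [hEval_derivative_logSeries, hEval_derivative_derivative_logSeries, smul_mul_smul_comm,
    smul_smul, smul_smul, mul_comm (hbar k), half_mul_hbar,
    show 4 * eta k * (2 * 2) = 16 * eta k by ring, ← mul_smul_comm, h2] at h1
  rw [xOf] at h1 ⊢
  rw [h1, add_sub_assoc]
  simp only [mul_sub, mul_assoc, reassoc (expH_mul_neg k _), expH_mul_neg, mul_one, one_mul]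

/-- The Jordanian relation for `[H, X]`. -/
theorem SlTriple.hx {P Z M : C} (h : SlTriple k P Z M) :
    hOf k P Z * xOf k P - xOf k P * hOf k P Z = hEvalDiv (xOf k P) (twoSinh k) := by
  have hX := Commute.refl (xOf k P)
  have hU : Commute (expH k (-xOf k P)) (xOf k P) := expH_commute k hX.neg_left
  have hTP : Commute (expH k (xOf k P)) P :=
    expH_commute k (commute_xOf (Commute.refl P))
  have h2 := two_smul_plusOf (k := k) (xOf k P)
  rw [plusOf_xOf] at h2
  have h3 : hEvalDiv (xOf k P) (twoSinh k) = ((2 : k⟦X⟧) • P) * expH k (xOf k P) := by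
    rw [← h2, mul_assoc, expH_neg_mul, mul_one]
  rw [h3, hOf, ← mul_assoc (xOf k P), ← hU.eq, mul_assoc, mul_assoc, ← mul_sub, h.zx, ← mul_assoc,
    ← mul_assoc, expH_neg_mul, one_mul, mul_smul_comm, smul_mul_assoc, hTP.eq]

/-- `[J₀, T] = T³ - T`. -/
theorem z_mul_expH {X Z : C}
    (HX : expH k (-X) * Z * X - X * (expH k (-X) * Z) = hEvalDiv X (twoSinh k)) :
    Z * expH k X = expH k X * Z + expH k X * expH k X * expH k X - expH k X := by
  have h := congrArg (fun y => expH k X * y) (mul_expH HX)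
  simp only [mul_add, mul_sub, mul_one, ← mul_assoc, expH_mul_neg, one_mul] at h
  exact h

/-- An `sl(2)` triple gives Jordanian generators. -/
theorem SlTriple.jTriple {P Z M : C} (h : SlTriple k P Z M) :
    JTriple k (xOf k P) (hOf k P Z) (yOf k P Z M) := by
  have hX := Commute.refl (xOf k P)
  have hU : Commute (expH k (-xOf k P)) (xOf k P) := expH_commute k hX.neg_left
  have HX := h.hx
  have XY : xOf k P * yOf k P Z M - yOf k P Z M * xOf k P = hOf k P Z := by
    have h1 := xy_identity (eta k) (expH_mul_neg k (xOf k P)) hU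
      (expH_commute k hX) (smul_eq_one_sub P) h.ZP (z_mul_expH h.hx) h.zx h.xm
    rw [yOf, half_mul_hbar, ← eta]
    exact h1
  refine ⟨HX, ?_, XY⟩
  -- The left side of `zm_identity_of` vanishes by `[J₀, J₋] = -2 J₋`, and `T²` can be cancelled.
  have h1 := zm_identity_of HX XY
  rw [minusOf_yOf, mul_hOf, h.ZM, ← add_smul] at h1
  have h2 := congrArg (fun y => expH k (-xOf k P) * (expH k (-xOf k P) * y)) h1
  simp only [neg_add_cancel, zero_smul, mul_zero, mul_assoc, reassoc (expH_neg_mul k (xOf k P)),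
    one_mul] at h2
  have h3 := h2.symm
  rw [add_assoc, add_eq_zero_iff_eq_neg] at h3
  rw [h3, neg_add']

end Triples

/-! ### Conjugation by the twist -/

section Twist

variable {R : Type*} [CommRing R] {C : Type*} [Ring C] [Algebra R C]

/-- For commuting copies 1 and 2 of the generators, the left side is what conjugation by the twist
makes of `M₁ + M₂`, and the right side is the expression for `J₋` in the Jordanian coproducts
`H₁ T₂ + U₁ H₂`, `Y₁ T₂ + U₁ Y₂` and `T₁ T₂` of the generators, with `U₁ = T₁⁻¹`. -/
theorem minus_identity {T₁ U₁ H₁ Y₁ Z₁ M₁ T₂ H₂ Y₂ Z₂ M₂ : C} (η : R)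
    (T₁U₁ : T₁ * U₁ = 1) (h1 : Commute T₁ T₂) (h2 : Commute H₁ T₂) (h3 : Commute Y₁ T₂)
    (h5 : Commute Z₁ Z₂)
    (hZ₁ : Z₁ = T₁ * H₁) (hZ₂ : Z₂ = T₂ * H₂)
    (hM₁ : M₁ = T₁ * Y₁ - (4 * η) • Z₁ ^ 2 - η • (T₁ ^ 2 - 1))
    (hM₂ : M₂ = T₂ * Y₂ - (4 * η) • Z₂ ^ 2 - η • (T₂ ^ 2 - 1))
    (ZT : Z₂ * T₂ = T₂ * Z₂ + T₂ * T₂ * T₂ - T₂) :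
    T₂ * T₂ * M₁ + (M₂ - (8 * η) • (Z₁ * (T₂ * T₂ * Z₂ + T₂ * T₂ * (T₂ * T₂) - T₂ * T₂))
      - (4 * η) • (Z₁ * Z₁ * (T₂ * T₂ * (T₂ * T₂) - T₂ * T₂))) =
    T₁ * T₂ * (Y₁ * T₂ + U₁ * Y₂) - (4 * η) • (T₁ * T₂ * (H₁ * T₂ + U₁ * H₂)) ^ 2
      - η • ((T₁ * T₂) ^ 2 - 1) := by
  have h6 : Commute Z₁ T₂ := by rw [hZ₁]; exact h1.mul_left h2
  have e1 : T₁ * T₂ * (H₁ * T₂ + U₁ * H₂) = T₂ * (T₂ * Z₁) + Z₂ := by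
    rw [hZ₁, hZ₂, mul_add, h2.eq, h1.eq]
    simp only [mul_assoc, reassoc h1.eq, reassoc T₁U₁, one_mul]
  have e2 : T₁ * T₂ * (Y₁ * T₂ + U₁ * Y₂) = T₂ * (T₂ * (T₁ * Y₁)) + T₂ * Y₂ := by
    rw [mul_add, h3.eq, h1.eq]
    simp only [mul_assoc, reassoc h1.eq, reassoc T₁U₁, one_mul]
  rw [e1, e2, hM₁, hM₂]
  have h5' := h5.symm.eq
  have h6' := h6.eq
  have h1' := h1.eq
  simp only [pow_two, mul_add, add_mul, mul_sub, sub_mul, mul_assoc,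
    mul_smul_comm, smul_add, smul_sub, mul_one, reassoc ZT, h5', h6',
    reassoc h6', h1', reassoc h1']
  module

end Twist

section Conjugation

open PowerSeries (coeff constantCoeff derivative)

variable {k : Type u} [Field k] [CharZero k] {C : Type u} [Ring C] [Algebra k⟦X⟧ C]
  [HComplete k C]

theorem hEvalDiv_plusSeries (x : C) : hEvalDiv x (plusSeries k) =
    PowerSeries.C (1 / 2 : k) • -hEvalDiv x (PowerSeries.rescale (-2) (PowerSeries.exp k)) := by
  rw [plusSeries, hEvalDiv_C_mul, map_sub, hEvalDiv_one, zero_sub]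

/-- The expression `(1 - e^{-2h(x + y)}) / (2h)` for commuting `x` and `y`. -/
theorem plusOf_add {x y : C} (h : Commute x y) :
    plusOf k (x + y) = plusOf k x * (expH k (-y) * expH k (-y)) + plusOf k y := by
  rw [plusOf, plusOf, plusOf, hEvalDiv_plusSeries, hEvalDiv_plusSeries, hEvalDiv_plusSeries,
    hEvalDiv_rescale_exp_add h, hEval_rescale_neg_two, smul_mul_assoc, ← smul_add, neg_add, neg_mul]

theorem expH_smul_neg_two (x : C) :
    expH k (PowerSeries.C (-2 : k) • x) = expH k (-x) * expH k (-x) := by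
  rw [← hEval_rescale_exp, hEval_rescale_neg_two]

theorem expH_smul_two (x : C) : expH k (PowerSeries.C (2 : k) • x) = expH k x * expH k x := by
  rw [← hEval_rescale_exp, hEval_rescale_two]

/-- If `[x, w] = w r`, conjugation by `e^{hx}` multiplies `w` by `e^{hr}`. -/
theorem expH_mul_of_commutator {x w r : C} (h : x * w = w * (x + r)) (hr : Commute x r)
    (hw : Commute r w) : expH k x * w = expH k r * w * expH k x := by
  have h1 : expH k x * w = w * expH k (x + r) := hEval_mul_of_mul_eq h _
  rw [h1, expH_add k hr, ← (expH_commute k hw).eq.symm, mul_assoc,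
    (expH_commute k (expH_commute k hr.symm).symm).eq]

/-- Conjugation by `e^{hx}` when the iterated commutators with `x` stop after the second. -/
theorem expH_mul_of_commutator_commutator {x w c s : C} (hw : x * w - w * x = c)
    (hs : c * x - x * c = s) (hc : Commute x s) :
    expH k x * w = (w + hbar k • c - hbar k • (4 * eta k) • s) * expH k x := by
  have h1 := hEval_commutator hw hs hc (PowerSeries.exp k)
  have h2 := commutator_hEval hs hc (PowerSeries.exp k)
  rw [PowerSeries.derivative_exp, PowerSeries.derivative_exp] at h1
  rw [PowerSeries.derivative_exp] at h2
  change expH k x * w - w * expH k x = hbar k • (expH k x * c + hbar k •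
    PowerSeries.C (1 / 2 : k) • (expH k x * s)) at h1
  change c * expH k x - expH k x * c = hbar k • (expH k x * s) at h2
  have h3 : expH k x * w = w * expH k x + (expH k x * w - w * expH k x) := by abel
  have h4 : expH k x * c = c * expH k x - hbar k • (expH k x * s) := by rw [← h2]; abel
  have h5 := half_add_half_smul (k := k) (hbar k • (expH k x * s))
  rw [← h5] at h4
  rw [h3, h1, h4, smul_comm (hbar k) (PowerSeries.C (1 / 2 : k)), sub_add,
    add_sub_cancel_right, ← half_mul_hbar, mul_smul, (expH_commute k hc).eq]
  simp only [sub_mul, add_mul, smul_mul_assoc, smul_sub]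
  abel

theorem hbar_smul_exp_sq_mul (X : C) :
    hbar k • (expH k X * expH k X * ((2 : k⟦X⟧) • plusOf k X)) = expH k X * expH k X - 1 := by
  rw [← mul_smul_comm, smul_smul, mul_comm (hbar k), hbar_smul_plusOf, mul_sub, mul_one, mul_assoc,
    reassoc (expH_mul_neg k X), one_mul, expH_mul_neg]

theorem commute_exp_sq_mul (X : C) :
    Commute X (expH k X * expH k X * ((2 : k⟦X⟧) • plusOf k X)) := by
  have hT : Commute X (expH k X) := (expH_commute k (Commute.refl X)).symm
  have hP : Commute X (plusOf k X) := (hEvalDiv_commute (Commute.refl X) _).symm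
  exact (hT.mul_right hT).mul_right (hP.smul_right _)

variable {B : Type u} [Ring B] [Algebra k⟦X⟧ B]

section

variable [HComplete k B]

theorem map_expH (f : B →ₐ[k⟦X⟧] C) (x : B) : f (expH k x) = expH k (f x) := map_hEval f x _

theorem map_plusOf (f : B →ₐ[k⟦X⟧] C) (x : B) : f (plusOf k x) = plusOf k (f x) :=
  map_hEvalDiv f x _

theorem map_xOf (f : B →ₐ[k⟦X⟧] C) (x : B) : f (xOf k x) = xOf k (f x) :=
  map_hEvalDiv f x _

theorem map_minusOf (f : B →ₐ[k⟦X⟧] C) (x y z : B) :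
    f (minusOf k x y z) = minusOf k (f x) (f y) (f z) := by
  simp [minusOf, map_expH]

theorem map_hOf (f : B →ₐ[k⟦X⟧] C) (x y : B) : f (hOf k x y) = hOf k (f x) (f y) := by
  simp [hOf, map_expH, map_xOf]

theorem map_yOf (f : B →ₐ[k⟦X⟧] C) (x y z : B) :
    f (yOf k x y z) = yOf k (f x) (f y) (f z) := by
  simp [yOf, map_expH, map_xOf]

end

variable {i j : B →ₐ[k⟦X⟧] C} (hij : ∀ a b, Commute (i a) (j b))

include hij

/-- If `[Z, w] = r w` in the first factor, conjugation by `e^{-h Z ⊗ x}` multiplies `w` by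
`e^{-h r x}` in the second factor. -/
theorem twist_mul_left (r : k) {Z w : B} (h : Z * w - w * Z = PowerSeries.C r • w) (x : B) :
    expH k (-(i Z * j x)) * i w =
      expH k (PowerSeries.C (-r) • j x) * i w * expH k (-(i Z * j x)) := by
  refine expH_mul_of_commutator ?_ ?_ ?_
  · have hw := congrArg i h
    rw [map_sub, map_mul, map_mul, map_smul, sub_eq_iff_eq_add] at hw
    rw [neg_mul, mul_assoc, ← (hij _ _).eq, ← mul_assoc, hw, map_neg, mul_add,
      add_mul, smul_mul_assoc, neg_smul, mul_neg, mul_neg, mul_smul_comm, mul_assoc]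
    abel
  · exact (((hij _ _).mul_left (Commute.refl _)).neg_left).smul_right _
  · exact ((hij _ _).symm).smul_left _

theorem commute_twist_left {Z x a : B} (h : Commute Z a) :
    Commute (expH k (-(i Z * j x))) (i a) :=
  expH_commute k (((h.map i).mul_left (hij _ _).symm).neg_left)

theorem commute_twist_right {Z x a : B} (h : Commute x a) :
    Commute (expH k (-(i Z * j x))) (j a) :=
  expH_commute k (((hij _ _).mul_left (h.map j)).neg_left)

/-- Conjugation by `e^{-h Z ⊗ x}` of an element `w` of the second factor whose iterated
commutators with `x` stop after the second. -/
theorem twist_mul_right {Z x w c s : B} (hw : x * w - w * x = c) (hs : c * x - x * c = s)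
    (hc : Commute x s) :
    expH k (-(i Z * j x)) * j w = (j w - i Z * j (hbar k • c)
      - i Z * i Z * j (hbar k • (4 * eta k) • s)) * expH k (-(i Z * j x)) := by
  have h := (hij Z x).eq
  have e := expH_mul_of_commutator_commutator (k := k) (x := -(i Z * j x)) (w := j w)
    (c := -(i Z * j c)) (s := i Z * i Z * j s) ?_ ?_ ?_
  · rw [e, smul_neg, ← sub_eq_add_neg]
    simp only [map_smul, mul_smul_comm]
  · have h1 := (hij Z w).eq
    rw [← hw, map_sub, map_mul, map_mul, neg_mul, mul_neg, ← mul_assoc (j w), ← h1, mul_sub,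
      mul_assoc, mul_assoc]
    abel
  · have h1 := (hij Z c).eq
    rw [← hs, map_sub, map_mul, map_mul, neg_mul_neg, neg_mul_neg, mul_sub, mul_assoc (i Z) (j c),
      ← mul_assoc (j c) (i Z), ← h1, mul_assoc (i Z) (j x), ← mul_assoc (j x) (i Z), ← h]
    simp only [mul_assoc]
  · refine Commute.neg_left (Commute.mul_left ?_ ?_)
    · exact ((Commute.refl _).mul_right (Commute.refl _)).mul_right (hij _ _)
    · exact ((hij Z x).symm.mul_right (hij Z x).symm).mul_right (hc.map j)

variable [HComplete k B]

/-- The twist conjugates the primitive coproduct of `J₊` into the Jordanian one. -/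
theorem twist_mul_plus {X H Y : B} (h : JTriple k X H Y) :
    expH k (-(i (expH k X * H) * j X)) * (i (plusOf k X) + j (plusOf k X)) =
      plusOf k (i X + j X) * expH k (-(i (expH k X * H) * j X)) := by
  have e1 := twist_mul_left hij 2 (by rw [map_ofNat]; exact h.slTriple.ZP) X
  have e2 := commute_twist_right hij (Z := expH k X * H)
    ((hEvalDiv_commute (Commute.refl X) (plusSeries k)).symm)
  rw [← plusOf] at e2
  rw [mul_add, e1, e2.eq, plusOf_add (hij X X), expH_smul_neg_two, ← add_mul, ← map_neg,
    ← map_expH, ← map_mul, ← map_plusOf, ← map_plusOf, (hij (plusOf k X) _).eq]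

/-- The twist conjugates the primitive coproduct of `J₀` into `Δ(T) Δ(H)`. -/
theorem twist_mul_zero {X H Y : B} (h : JTriple k X H Y) :
    expH k (-(i (expH k X * H) * j X)) * (i (expH k X * H) + j (expH k X * H)) =
      (expH k (i X + j X) * (i H * j (expH k X) + i (expH k (-X)) * j H)) *
        expH k (-(i (expH k X * H) * j X)) := by
  have hZX := h.slTriple.zx
  rw [xOf_plusOf] at hZX
  have e1 := commute_twist_left hij (x := X) (Commute.refl (expH k X * H))
  have e2 := twist_mul_right hij (Z := expH k X * H) (w := expH k X * H) (x := X) (s := 0)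
    (c := -(expH k X * expH k X * ((2 : k⟦X⟧) • plusOf k X))) (by rw [← hZX]; abel)
    (sub_eq_zero.2 (commute_exp_sq_mul X).symm.neg_left.eq) (Commute.zero_right _)
  rw [smul_neg, hbar_smul_exp_sq_mul] at e2
  rw [mul_add, e1.eq, e2, ← add_mul, expH_add k (hij X X), ← map_expH, ← map_expH]
  congr 1
  have h1 := (hij H (expH k X)).eq
  have h2 := (hij (expH k X) (expH k X)).eq
  have h3 : i (expH k X) * i (expH k (-X)) = 1 := by rw [← map_mul, expH_mul_neg, map_one]
  simp only [smul_zero, map_zero, mul_zero, sub_zero, map_neg, map_sub, map_mul, map_one, mul_neg,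
    mul_sub, mul_one, mul_add, h1, h2, mul_assoc, reassoc h1, reassoc h2, reassoc h3, one_mul]
  abel

/-- The twist conjugates the primitive coproduct of `J₋` into the expression for `J₋` in the
Jordanian coproducts of the generators. -/
theorem twist_mul_minus {X H Y : B} (h : JTriple k X H Y) :
    expH k (-(i (expH k X * H) * j X)) * (i (minusOf k X H Y) + j (minusOf k X H Y)) =
      minusOf k (i X + j X) (i H * j (expH k X) + i (expH k (-X)) * j H)
        (i Y * j (expH k X) + i (expH k (-X)) * j Y) *
        expH k (-(i (expH k X * H) * j X)) := by
  have hsl := h.slTriple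
  have hZX := hsl.zx
  have hXM := hsl.xm
  rw [xOf_plusOf] at hZX hXM
  have hT : Commute X (expH k X) := (expH_commute k (Commute.refl X)).symm
  have hT2 := (hT.mul_right hT).eq
  have e1 := twist_mul_left hij (-2) (Z := expH k X * H) (w := minusOf k X H Y)
    (by rw [map_neg, map_ofNat]; exact hsl.ZM) X
  have e2 := twist_mul_right hij (Z := expH k X * H) (w := minusOf k X H Y) (x := X)
    (c := expH k X * expH k X * (expH k X * H) + expH k X * expH k X * (expH k X * expH k X) -
      expH k X * expH k X)
    (s := expH k X * expH k X * (expH k X * expH k X * ((2 : k⟦X⟧) • plusOf k X)))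
    hXM ?_ ((hT.mul_right hT).mul_right (commute_exp_sq_mul X))
  · rw [smul_comm (hbar k), ← mul_smul_comm, hbar_smul_exp_sq_mul] at e2
    rw [neg_neg, expH_smul_two] at e1
    rw [mul_add, e1, e2, ← add_mul]
    congr 1
    rw [minusOf_eq (i X + j X), expH_add k (hij X X), ← map_expH, ← map_expH]
    have hZT : expH k X * H * expH k X =
        expH k X * (expH k X * H) + expH k X * expH k X * expH k X - expH k X :=
      z_mul_expH (by rw [reassoc (expH_neg_mul k X), one_mul]; exact h.HX)
    have hZT' := congrArg j hZT
    have key := minus_identity (R := k⟦X⟧) (T₁ := i (expH k X)) (U₁ := i (expH k (-X)))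
      (H₁ := i H) (Y₁ := i Y) (Z₁ := i (expH k X * H)) (M₁ := i (minusOf k X H Y))
      (T₂ := j (expH k X)) (H₂ := j H) (Y₂ := j Y) (Z₂ := j (expH k X * H))
      (M₂ := j (minusOf k X H Y)) (eta k) (by rw [← map_mul, expH_mul_neg, map_one]) (hij _ _)
      (hij _ _) (hij _ _) (hij _ _) (map_mul _ _ _) (map_mul _ _ _)
      (by rw [minusOf_eq]; simp) (by rw [minusOf_eq]; simp) (by simpa using hZT')
    rw [← key, hbar_eq]
    simp only [map_smul, map_mul, map_add, map_sub, mul_smul_comm, mul_sub, mul_one,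
      mul_assoc]
  · have hZX' : expH k X * H * X = X * (expH k X * H) +
        expH k X * expH k X * ((2 : k⟦X⟧) • plusOf k X) := by rw [← hZX]; abel
    have hT4 := ((hT.mul_right hT).mul_right (hT.mul_right hT)).eq
    rw [mul_sub, mul_add, sub_mul, add_mul, mul_assoc _ (expH k X * H) X, hZX', hT2, hT4, mul_add,
      ← mul_assoc X _ (expH k X * H), hT2, mul_assoc _ X]
    abel

end Conjugation

/-! ### The universal property of the Jordanian algebra -/

section Jordan

variable {k : Type u} [Field k] {C : Type u} [Ring C] [Algebra k⟦X⟧ C]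

/-- A map from the names of the generators. -/
def onGen (X H Y : C) : Gen → C
  | Gen.X => X
  | Gen.H => H
  | Gen.Y => Y

/-- The algebra map out of the completed free algebra with given values on the generators. -/
def freeLift [HComplete k C] (X H Y : C) : HComp k (Free k) →ₐ[k⟦X⟧] C :=
  hLift (FreeAlgebra.lift k⟦X⟧ (onGen X H Y))

theorem freeLift_freeGen [HComplete k C] (X H Y : C) (g : Gen) :
    freeLift X H Y (freeGen k g) = onGen X H Y g := by
  rw [freeLift, freeGen, hLift_toHComp, FreeAlgebra.lift_ι_apply]

variable [HComplete k C] [CharZero k]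

theorem freeSinh_eq : freeSinh k = hEvalDiv (freeGen k Gen.X) (twoSinh k) :=
  hSeriesDiv_eq_hEvalDiv _ _

theorem freeCosh_eq : freeCosh k = hEval (freeGen k Gen.X) (coshSeries k) :=
  hSeries_eq_hEval _ _

variable (k) in
/-- The map from the completed free algebra to a dense subalgebra of `U_h(sl(2))`. -/
def freeToUh : HComp k (Free k) →ₐ[k⟦X⟧] Uh k :=
  (toHComp k).comp (RingQuot.mkAlgHom k⟦X⟧ (JRel k))

theorem freeToUh_freeGen (g : Gen) : freeToUh k (freeGen k g) = gen k g := rfl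

theorem freeToUh_rel {a b : HComp k (Free k)} (h : JRel k a b) : freeToUh k a = freeToUh k b :=
  congrArg (toHComp k) (RingQuot.mkAlgHom_rel k⟦X⟧ h)

variable (k) in
theorem jTriple_gen : JTriple k (gen k Gen.X) (gen k Gen.H) (gen k Gen.Y) where
  HX := by
    have h := freeToUh_rel (k := k) JRel.HX
    simpa only [map_sub, map_mul, freeSinh_eq, map_hEvalDiv, freeToUh_freeGen] using h
  HY := by
    have h := freeToUh_rel (k := k) JRel.HY
    simpa only [map_sub, map_neg, map_mul, freeCosh_eq, map_hEval, freeToUh_freeGen] using h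
  XY := by
    have h := freeToUh_rel (k := k) JRel.XY
    simpa only [map_sub, map_mul, freeToUh_freeGen] using h

/-- The algebra map out of `U_h(sl(2))` given by three elements that satisfy the relations. -/
def jordanLift {X H Y : C} (h : JTriple k X H Y) : Uh k →ₐ[k⟦X⟧] C :=
  hLift (RingQuot.liftAlgHom k⟦X⟧ ⟨freeLift X H Y, by
    intro a b hab
    cases hab with
    | HX => simpa only [map_sub, map_mul, freeSinh_eq, map_hEvalDiv, freeLift_freeGen, onGen] using h.HX
    | HY =>
      simpa only [map_sub, map_neg, map_mul, freeCosh_eq, map_hEval, freeLift_freeGen,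
        onGen] using h.HY
    | XY => simpa only [map_sub, map_mul, freeLift_freeGen, onGen] using h.XY⟩)

theorem jordanLift_gen {X H Y : C} (h : JTriple k X H Y) (g : Gen) :
    jordanLift h (gen k g) = onGen X H Y g := by
  rw [jordanLift, gen, hLift_toHComp, preGen, RingQuot.liftAlgHom_mkAlgHom_apply,
    freeLift_freeGen]

/-- `U_h(sl(2))` is topologically generated by `X, H, Y`. -/
theorem Uh.algHom_ext {f g : Uh k →ₐ[k⟦X⟧] C} (h : ∀ x, f (gen k x) = g (gen k x)) : f = g := by
  refine HComp.algHom_ext fun a => ?_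
  refine DFunLike.congr_fun (f := f.comp (toHComp k)) (g := g.comp (toHComp k)) ?_ a
  refine RingQuot.ringQuot_ext' _ _ _ ?_
  refine HComp.algHom_ext fun b => ?_
  refine DFunLike.congr_fun (f := (f.comp (freeToUh k)).comp (toHComp k))
    (g := (g.comp (freeToUh k)).comp (toHComp k)) ?_ b
  refine FreeAlgebra.hom_ext (funext fun x => ?_)
  exact h x

variable (k)

theorem T_eq : T k = expH k (gen k Gen.X) := hSeries_eq_hEval _ _

theorem Tinv_eq : Tinv k = expH k (-gen k Gen.X) := by
  rw [Tinv, hExp, hSeries_eq_hEval, map_neg]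
  rfl

theorem JPlus_eq : JPlus k = plusOf k (gen k Gen.X) := hSeriesDiv_eq_hEvalDiv _ _

theorem JZero_eq : JZero k = expH k (gen k Gen.X) * gen k Gen.H := by rw [JZero, T_eq]

theorem JMinus_eq : JMinus k = minusOf k (gen k Gen.X) (gen k Gen.H) (gen k Gen.Y) := by
  rw [JMinus, T_eq, minusOf]

end Jordan

/-! ### The universal property of the classical algebra -/

section Classical

attribute [local instance 100] LieRing.ofAssociativeRing

/-- The commutator of two combinations of `P, Z, M`, in the coordinates of traceless matrices. -/
theorem lie_identity {R : Type*} [CommRing R] {C : Type*} [Ring C] [Algebra R C] {P Z M : C}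
    (ZP : Z * P - P * Z = (2 : R) • P) (ZM : Z * M - M * Z = (-2 : R) • M)
    (PM : P * M - M * P = Z) (a b c a' b' c' : R) :
    (b * c' - b' * c) • Z + (2 * (a * b' - a' * b)) • P + (2 * (c * a' - c' * a)) • M =
    (b • P + a • Z + c • M) * (b' • P + a' • Z + c' • M) -
      (b' • P + a' • Z + c' • M) * (b • P + a • Z + c • M) := by
  have h1 : Z * P = P * Z + (2 : R) • P := by rw [← ZP]; abel
  have h2 : M * Z = Z * M + (2 : R) • M := by
    rw [← sub_eq_iff_eq_add', ← neg_sub, ZM, neg_smul, neg_neg]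
  have h3 : M * P = P * M - Z := by rw [← PM]; abel
  simp only [mul_add, add_mul, smul_mul_assoc, mul_smul_comm, h1, h2, h3, smul_add, smul_sub]
  module

variable {k : Type u} [Field k] {C : Type u} [Ring C] [Algebra k⟦X⟧ C]

theorem sl2_trace (x : sl2 k) : x.1 1 1 = -x.1 0 0 := by
  have h : Matrix.trace x.1 = 0 := x.2
  rw [Matrix.trace_fin_two] at h
  exact eq_neg_of_add_eq_zero_right h

/-- The Lie algebra map out of `sl(2)` given by three elements that satisfy the relations. -/
def slLieHom {P Z M : C} (h : SlTriple k P Z M) : sl2 k →ₗ⁅k⟦X⟧⁆ C where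
  toFun x := x.1 0 1 • P + x.1 0 0 • Z + x.1 1 0 • M
  map_add' x y := by
    change (x.1 0 1 + y.1 0 1) • P + (x.1 0 0 + y.1 0 0) • Z + (x.1 1 0 + y.1 1 0) • M = _
    simp only [add_smul]
    abel
  map_smul' r x := by
    change (r * x.1 0 1) • P + (r * x.1 0 0) • Z + (r * x.1 1 0) • M = _
    simp only [mul_smul, smul_add, RingHom.id_apply]
  map_lie' := by
    intro x y
    have e : ∀ i j, (⁅x, y⁆ : sl2 k).1 i j = (x.1 * y.1 - y.1 * x.1) i j := fun i j => rfl
    have hx := sl2_trace x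
    have hy := sl2_trace y
    change (⁅x, y⁆ : sl2 k).1 0 1 • P + (⁅x, y⁆ : sl2 k).1 0 0 • Z + (⁅x, y⁆ : sl2 k).1 1 0 • M = _
    rw [Ring.lie_def, ← lie_identity h.ZP h.ZM h.PM, e, e, e]
    simp only [Matrix.sub_apply, Matrix.mul_apply, Fin.sum_univ_two, hx, hy]
    rw [add_comm (_ • P)]
    congr 3 <;> ring

theorem sl2_decomp (x : sl2 k) :
    x = x.1 0 1 • slPlus k + x.1 0 0 • slZero k + x.1 1 0 • slMinus k := by
  apply Subtype.ext
  have h := sl2_trace x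
  ext1 i j
  change _ = x.1 0 1 * (slPlus k).1 i j + x.1 0 0 * (slZero k).1 i j +
    x.1 1 0 * (slMinus k).1 i j
  fin_cases i <;> fin_cases j <;> simp [slPlus, slZero, slMinus, h]

theorem clGen_lie (x y : sl2 k) :
    clGen k ⁅x, y⁆ = clGen k x * clGen k y - clGen k y * clGen k x := by
  simp only [clGen, LieHom.map_lie, Ring.lie_def, map_sub, map_mul]

theorem clGen_smul (r : k⟦X⟧) (x : sl2 k) : clGen k (r • x) = r • clGen k x := by
  simp only [clGen, map_smul]

variable (k) in
theorem slTriple_clGen : SlTriple k (clGen k (slPlus k)) (clGen k (slZero k))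
    (clGen k (slMinus k)) := by
  obtain ⟨h1, h2, h3⟩ := sl_relations k
  refine ⟨?_, ?_, ?_⟩
  · rw [← clGen_lie, h1, clGen_smul]
  · rw [← clGen_lie, h2, clGen_smul]
  · rw [← clGen_lie, h3]

/-- The algebra map out of `U(sl(2))[[h]]` given by three elements that satisfy the relations. -/
def slLift [HComplete k C] {P Z M : C} (h : SlTriple k P Z M) : Ucl k →ₐ[k⟦X⟧] C :=
  hLift (UniversalEnvelopingAlgebra.lift k⟦X⟧ (slLieHom h))

section

variable [HComplete k C] {P Z M : C} (h : SlTriple k P Z M)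

theorem slLift_clGen (x : sl2 k) :
    slLift h (clGen k x) = x.1 0 1 • P + x.1 0 0 • Z + x.1 1 0 • M := by
  rw [slLift, clGen, hLift_toHComp, UniversalEnvelopingAlgebra.lift_ι_apply]
  rfl

theorem slLift_plus : slLift h (clGen k (slPlus k)) = P := by
  rw [slLift_clGen]; simp [slPlus]

theorem slLift_zero : slLift h (clGen k (slZero k)) = Z := by
  rw [slLift_clGen]; simp [slZero]

theorem slLift_minus : slLift h (clGen k (slMinus k)) = M := by
  rw [slLift_clGen]; simp [slMinus]

end

/-- `U(sl(2))[[h]]` is topologically generated by `J₊, J₀, J₋`. -/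
theorem Ucl.algHom_ext [HComplete k C] {f g : Ucl k →ₐ[k⟦X⟧] C}
    (h1 : f (clGen k (slPlus k)) = g (clGen k (slPlus k)))
    (h2 : f (clGen k (slZero k)) = g (clGen k (slZero k)))
    (h3 : f (clGen k (slMinus k)) = g (clGen k (slMinus k))) : f = g := by
  refine HComp.algHom_ext fun a => ?_
  refine DFunLike.congr_fun (f := f.comp (toHComp k)) (g := g.comp (toHComp k)) ?_ a
  refine UniversalEnvelopingAlgebra.hom_ext _ (LieHom.ext fun x => ?_)
  change f (clGen k x) = g (clGen k x)
  have hadd : ∀ x y : sl2 k, clGen k (x + y) = clGen k x + clGen k y := fun x y => by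
    simp only [clGen, map_add]
  rw [sl2_decomp x]
  simp only [hadd, clGen_smul, map_add, map_smul, h1, h2, h3]

theorem coprodCl_clGen (x : sl2 k) :
    coprodCl k (clGen k x) = tens (clGen k x) 1 + tens 1 (clGen k x) := by
  rw [coprodCl, clGen, mapHComp_toHComp, AlgHom.comp_apply,
    UniversalEnvelopingAlgebra.lift_ι_apply]
  change toHComp k (tensIncl k _ (_ ⊗ₜ 1 + 1 ⊗ₜ _)) = _
  rw [map_add, map_add]
  simp only [tensIncl, Algebra.TensorProduct.map_tmul, map_one]
  rfl

end Classical

/-! ### The minimal twist map, the coproduct and the twist -/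

section Final

variable (k : Type u) [Field k] [CharZero k]

/-- The minimal twist map `U(sl(2))[[h]] → U_h(sl(2))`. -/
def twistMap : Ucl k →ₐ[k⟦X⟧] Uh k := slLift (jTriple_gen k).slTriple

/-- The inverse of the minimal twist map. -/
def twistMapInv : Uh k →ₐ[k⟦X⟧] Ucl k := jordanLift (slTriple_clGen k).jTriple

theorem twistMap_plus : twistMap k (clGen k (slPlus k)) = JPlus k := by
  rw [twistMap, slLift_plus, JPlus_eq]

theorem twistMap_zero : twistMap k (clGen k (slZero k)) = JZero k := by
  rw [twistMap, slLift_zero, JZero_eq]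

theorem twistMap_minus : twistMap k (clGen k (slMinus k)) = JMinus k := by
  rw [twistMap, slLift_minus, JMinus_eq]

theorem twistMapInv_X : twistMapInv k (gen k Gen.X) = xOf k (clGen k (slPlus k)) :=
  jordanLift_gen _ _

theorem twistMapInv_H :
    twistMapInv k (gen k Gen.H) = hOf k (clGen k (slPlus k)) (clGen k (slZero k)) :=
  jordanLift_gen _ _

theorem twistMapInv_Y : twistMapInv k (gen k Gen.Y) =
    yOf k (clGen k (slPlus k)) (clGen k (slZero k)) (clGen k (slMinus k)) :=
  jordanLift_gen _ _

theorem twistMap_comp_inv : (twistMap k).comp (twistMapInv k) = AlgHom.id _ _ := by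
  refine Uh.algHom_ext fun g => ?_
  cases g
  · rw [AlgHom.comp_apply, twistMapInv_X, map_xOf, twistMap_plus, JPlus_eq, xOf_plusOf]
    rfl
  · rw [AlgHom.comp_apply, twistMapInv_H, map_hOf, twistMap_plus, twistMap_zero, JPlus_eq,
      JZero_eq, hOf_mul]
    rfl
  · rw [AlgHom.comp_apply, twistMapInv_Y, map_yOf, twistMap_plus, twistMap_zero, twistMap_minus,
      JPlus_eq, JZero_eq, JMinus_eq, yOf_minusOf]
    rfl

theorem twistMapInv_comp : (twistMapInv k).comp (twistMap k) = AlgHom.id _ _ := by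
  refine Ucl.algHom_ext ?_ ?_ ?_
  · rw [AlgHom.comp_apply, twistMap_plus, JPlus_eq, map_plusOf, twistMapInv_X, plusOf_xOf]
    rfl
  · rw [AlgHom.comp_apply, twistMap_zero, JZero_eq, map_mul, map_expH, twistMapInv_X,
      twistMapInv_H, mul_hOf]
    rfl
  · rw [AlgHom.comp_apply, twistMap_minus, JMinus_eq, map_minusOf, twistMapInv_X,
      twistMapInv_H, twistMapInv_Y, minusOf_yOf]
    rfl

/-- The minimal twist map is an isomorphism. -/
def twistEquiv : Ucl k ≃ₐ[k⟦X⟧] Uh k :=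
  AlgEquiv.ofAlgHom (twistMap k) (twistMapInv k) (twistMap_comp_inv k) (twistMapInv_comp k)

theorem twistEquiv_isMinimalTwistMap :
    IsMinimalTwistMap k (twistEquiv k : Ucl k →ₐ[k⟦X⟧] Uh k) :=
  ⟨twistMap_plus k, twistMap_zero k, twistMap_minus k⟩

/-- The inclusion of the first factor of the completed tensor square. -/
def inFst : Uh k →ₐ[k⟦X⟧] Tens k (Uh k) := (toHComp k).comp Algebra.TensorProduct.includeLeft

/-- The inclusion of the second factor of the completed tensor square. -/
def inSnd : Uh k →ₐ[k⟦X⟧] Tens k (Uh k) := (toHComp k).comp Algebra.TensorProduct.includeRight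

theorem tens_eq (a b : Uh k) : tens a b = inFst k a * inSnd k b := by
  simp [inFst, inSnd, tens, ← map_mul]

theorem tens_eq' (a b : Uh k) : tens a b = inSnd k b * inFst k a := by
  simp [inFst, inSnd, tens, ← map_mul]

theorem inFst_commute (a b : Uh k) : Commute (inFst k a) (inSnd k b) :=
  (tens_eq k a b).symm.trans (tens_eq' k a b)

theorem tens_one_add (a : Uh k) : tens a 1 + tens 1 a = inFst k a + inSnd k a := by
  simp [tens_eq]

theorem hExp_tmul (a b : Uh k) : hExp (a ⊗ₜ[k⟦X⟧] b) = expH k (tens a b) := hSeries_eq_hEval _ _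

theorem hExp_neg_tmul (a b : Uh k) : hExp (-(a ⊗ₜ[k⟦X⟧] b)) = expH k (-tens a b) := by
  rw [hExp, hSeries_eq_hEval, map_neg]
  rfl

theorem twistV_eq : twistV k = expH k
    (-(inFst k (expH k (gen k Gen.X) * gen k Gen.H) * inSnd k (gen k Gen.X))) := by
  rw [twistV, hExp_neg_tmul, tens_eq, T_eq]

/-- The twist as a unit. -/
def twistUnit : (Tens k (Uh k))ˣ where
  val := expH k (-tens (T k * gen k Gen.H) (gen k Gen.X))
  inv := expH k (tens (T k * gen k Gen.H) (gen k Gen.X))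
  val_inv := expH_neg_mul k _
  inv_val := expH_mul_neg k _

theorem twistUnit_val : (twistUnit k : Tens k (Uh k)) = twistV k := (hExp_neg_tmul k _ _).symm

variable {k}

theorem flip_tens (a b : Uh k) : flip k (Uh k) (tens a b) = tens b a := by
  rw [flip, tens, mapHComp_toHComp]
  rfl

theorem twistUnit_factorizes : Factorizes (twistUnit k) := by
  change RMat k = flip k (Uh k) (expH k (-tens _ _)) * expH k (tens _ _)
  rw [map_expH, map_neg, flip_tens, RMat, hExp_neg_tmul, hExp_tmul]

/-- The inner automorphism `a ↦ v a v⁻¹`. -/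
def innerConj {R A : Type*} [CommRing R] [Ring A] [Algebra R A] (v : Aˣ) : A →ₐ[R] A where
  toFun a := v * a * ↑v⁻¹
  map_one' := by simp
  map_mul' a b := by
    simp only [mul_assoc, Units.inv_mul_cancel_left]
  map_zero' := by simp
  map_add' a b := by rw [mul_add, add_mul]
  commutes' r := by rw [← (Algebra.commutes r (v : A)), mul_assoc, Units.mul_inv, mul_one]

variable (k)

/-- The coproduct `Φ ↦ V Δ̃_c(Φ) V⁻¹`, which turns out to be the Jordanian one. -/
def coprodJ : Uh k →ₐ[k⟦X⟧] Tens k (Uh k) :=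
  (innerConj (twistUnit k)).comp (coprodTransported (twistEquiv k))

theorem coprodTransported_apply (x : sl2 k) :
    coprodTransported (twistEquiv k) (twistMap k (clGen k x)) =
      tens (twistMap k (clGen k x)) 1 + tens 1 (twistMap k (clGen k x)) := by
  have h : (twistEquiv k).symm (twistMap k (clGen k x)) = clGen k x :=
    (twistEquiv k).symm_apply_apply _
  change tensMap _ (coprodCl k ((twistEquiv k).symm (twistMap k (clGen k x)))) = _
  rw [h, coprodCl_clGen, map_add]
  change toHComp k (Algebra.TensorProduct.map _ _ _) +
    toHComp k (Algebra.TensorProduct.map _ _ _) = _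
  rw [Algebra.TensorProduct.map_tmul, Algebra.TensorProduct.map_tmul, map_one]
  rfl

theorem coprodTransported_of_mem {J : Uh k}
    (hJ : J ∈ ({JPlus k, JZero k, JMinus k} : Set (Uh k))) :
    coprodTransported (twistEquiv k) J = tens J 1 + tens 1 J := by
  rcases hJ with rfl | rfl | rfl
  · rw [← twistMap_plus, coprodTransported_apply]
  · rw [← twistMap_zero, coprodTransported_apply]
  · rw [← twistMap_minus, coprodTransported_apply]

/-- A conjugation formula for the primitive element of `J` computes `coprodJ` at `J`. -/
theorem coprodJ_eq_of {J a : Uh k} {b : Tens k (Uh k)}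
    (hJ : J ∈ ({JPlus k, JZero k, JMinus k} : Set (Uh k))) (ha : J = a)
    (h : expH k (-(inFst k (expH k (gen k Gen.X) * gen k Gen.H) * inSnd k (gen k Gen.X))) *
      (inFst k a + inSnd k a) = b *
        expH k (-(inFst k (expH k (gen k Gen.X) * gen k Gen.H) * inSnd k (gen k Gen.X)))) :
    coprodJ k a = b := by
  rw [← twistV_eq, ← twistUnit_val] at h
  change ↑(twistUnit k) * coprodTransported (twistEquiv k) a * ↑(twistUnit k)⁻¹ = b
  rw [← ha, coprodTransported_of_mem k hJ, tens_one_add, ha, h, Units.mul_inv_cancel_right]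

theorem coprodJ_isJordanianCoproduct : IsJordanianCoproduct k (coprodJ k) := by
  have hp := coprodJ_eq_of k (Or.inl rfl) (JPlus_eq k)
    (twist_mul_plus (inFst_commute k) (jTriple_gen k))
  have hz := coprodJ_eq_of k (Or.inr (Or.inl rfl)) (JZero_eq k)
    (twist_mul_zero (inFst_commute k) (jTriple_gen k))
  have hm := coprodJ_eq_of k (Or.inr (Or.inr rfl)) (JMinus_eq k)
    (twist_mul_minus (inFst_commute k) (jTriple_gen k))
  -- `X` is a series in `J₊`; then `H` and `Y` come from `J₀` and `J₋` by cancelling `Δ(T)`.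
  have hX : coprodJ k (gen k Gen.X) = inFst k (gen k Gen.X) + inSnd k (gen k Gen.X) := by
    rw [← xOf_plusOf (k := k) (gen k Gen.X), map_xOf, hp, xOf_plusOf, xOf_plusOf]
  have hcancel : ∀ {x a b : Tens k (Uh k)}, expH k x * a = expH k x * b → a = b := by
    intro x a b h
    have h1 := congrArg (fun y => expH k (-x) * y) h
    simpa only [reassoc (expH_neg_mul k x), one_mul] using h1
  have hH : coprodJ k (gen k Gen.H) = tens (gen k Gen.H) (T k) + tens (Tinv k) (gen k Gen.H) := by
    rw [map_mul, map_expH, hX] at hz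
    rw [tens_eq, tens_eq, T_eq, Tinv_eq]
    exact hcancel hz
  refine ⟨by rw [hX, tens_one_add], ?_, hH⟩
  rw [map_minusOf, hX, hH, tens_eq, tens_eq, T_eq, Tinv_eq, minusOf, minusOf] at hm
  rw [tens_eq, tens_eq, T_eq, Tinv_eq]
  exact hcancel (sub_left_injective (sub_left_injective hm))

theorem isJordanianCoproduct_unique {D D' : Uh k →ₐ[k⟦X⟧] Tens k (Uh k)}
    (h : IsJordanianCoproduct k D) (h' : IsJordanianCoproduct k D') : D' = D := by
  refine Uh.algHom_ext fun g => ?_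
  cases g
  · rw [h.onX, h'.onX]
  · rw [h.onH, h'.onH]
  · rw [h.onY, h'.onY]

theorem twistUnit_isTwist : IsTwist (coprodJ k) (twistEquiv k) (twistUnit k) := by
  intro Φ
  change ↑(twistUnit k)⁻¹ * (↑(twistUnit k) * coprodTransported (twistEquiv k) Φ *
    ↑(twistUnit k)⁻¹) * ↑(twistUnit k) = _
  rw [mul_assoc, Units.inv_mul_cancel_right, Units.inv_mul_cancel_left]

variable {k}

/-- Two factorizations of `R_h` differ by a symmetric factor. -/
theorem Factorizes.flip_eq {V F FS : (Tens k (Uh k))ˣ} (hV : Factorizes V) (hF : Factorizes F)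
    (h : F = V * FS) : flip k (Uh k) FS = FS := by
  subst h
  have h1 : flip k (Uh k) V * ↑V⁻¹ = flip k (Uh k) ↑(V * FS) * ↑(V * FS)⁻¹ := by
    rw [← hF, hV]
  rw [mul_inv_rev, Units.val_mul, Units.val_mul, map_mul, ← mul_assoc, Units.mul_left_inj,
    mul_assoc] at h1
  have h2 : IsUnit (flip k (Uh k) (V : Tens k (Uh k))) := V.isUnit.map (flip k (Uh k))
  have h3 := h2.mul_left_cancel ((mul_one _).trans h1)
  rw [← Units.mul_inv_eq_one]
  exact h3.symm

/-- Two twists for the same coproduct differ by a factor commuting with `Δ̃_c`. -/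
theorem IsTwist.conj_eq {D : Uh k →ₐ[k⟦X⟧] Tens k (Uh k)} {e : Ucl k ≃ₐ[k⟦X⟧] Uh k}
    {V F FS : (Tens k (Uh k))ˣ} (hV : IsTwist D e V) (hF : IsTwist D e F) (h : F = V * FS)
    (Φ : Uh k) : ↑FS * coprodTransported e Φ * ↑FS⁻¹ = coprodTransported e Φ := by
  subst h
  have h1 := hF Φ
  rw [mul_inv_rev, Units.val_mul, Units.val_mul] at h1
  have h2 : ↑FS⁻¹ * coprodTransported e Φ * ↑FS = coprodTransported e Φ := by
    conv_lhs => rw [← hV Φ]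
    rw [← h1]
    simp only [mul_assoc]
  conv_lhs => rw [← h2]
  simp only [mul_assoc, Units.mul_inv_cancel_left, Units.mul_inv, mul_one]

theorem two_hbar_smul_JPlus : (2 * hbar k) • JPlus k = 1 - Tinv k ^ 2 := by
  rw [JPlus_eq, hbar_smul_plusOf, Tinv_eq, pow_two]

theorem T_mul_Tinv : T k * Tinv k = 1 := by rw [T_eq, Tinv_eq, expH_mul_neg]

end Final

end Jordanian

end

theorem mainTheorem1 (k : Type*) [Field k] [CharZero k] :
    -- the formal meaning of `J₊ = (1 - T⁻²) / (2 h)`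
    (2 * Jordanian.hbar k) • Jordanian.JPlus k = 1 - Jordanian.Tinv k ^ 2 ∧
    Jordanian.T k * Jordanian.Tinv k = 1 ∧
    -- the minimal twist map is a uniquely determined algebra isomorphism
    ∃ e : Jordanian.Ucl k ≃ₐ[PowerSeries k] Jordanian.Uh k,
      Jordanian.IsMinimalTwistMap k e ∧
      (∀ f : Jordanian.Ucl k →ₐ[PowerSeries k] Jordanian.Uh k,
        Jordanian.IsMinimalTwistMap k f → f = e) ∧
      -- the Jordanian coproduct exists and is unique
      ∃ D : Jordanian.Uh k →ₐ[PowerSeries k] Jordanian.Tens k (Jordanian.Uh k),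
        Jordanian.IsJordanianCoproduct k D ∧
        (∀ D' : Jordanian.Uh k →ₐ[PowerSeries k] Jordanian.Tens k (Jordanian.Uh k),
          Jordanian.IsJordanianCoproduct k D' → D' = D) ∧
        -- `V` is invertible and makes the images of the classical generators primitive
        ∃ V : (Jordanian.Tens k (Jordanian.Uh k))ˣ,
          (V : Jordanian.Tens k (Jordanian.Uh k)) = Jordanian.twistV k ∧
          (∀ J ∈ ({Jordanian.JPlus k, Jordanian.JZero k, Jordanian.JMinus k} :
              Set (Jordanian.Uh k)),
            ((V⁻¹ : (Jordanian.Tens k (Jordanian.Uh k))ˣ) : Jordanian.Tens k (Jordanian.Uh k)) * D J * (V : Jordanian.Tens k (Jordanian.Uh k)) = Jordanian.tens J 1 + Jordanian.tens 1 J ∧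
            Jordanian.coprodTransported e J = Jordanian.tens J 1 + Jordanian.tens 1 J) ∧
          -- so `F = V` is the factorizing twist belonging to this map
          Jordanian.IsTwist D e V ∧
          Jordanian.Factorizes V ∧
          -- the factor `F_S = V⁻¹ F` of any factorizing twist for this map is symmetric and
          -- commutes with the classical coproduct
          (∀ F FS : (Jordanian.Tens k (Jordanian.Uh k))ˣ, F = V * FS →
            Jordanian.IsTwist D e F → Jordanian.Factorizes F →
            Jordanian.flip k (Jordanian.Uh k) FS = FS ∧
            (∀ J ∈ ({Jordanian.JPlus k, Jordanian.JZero k, Jordanian.JMinus k} :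
                Set (Jordanian.Uh k)),
              (FS : Jordanian.Tens k (Jordanian.Uh k)) * Jordanian.coprodTransported e J *
                ((FS⁻¹ : (Jordanian.Tens k (Jordanian.Uh k))ˣ) : Jordanian.Tens k (Jordanian.Uh k)) =
                Jordanian.coprodTransported e J)) := by

  refine ⟨Jordanian.two_hbar_smul_JPlus, Jordanian.T_mul_Tinv, Jordanian.twistEquiv k,
    Jordanian.twistEquiv_isMinimalTwistMap k, fun f hf => ?_, Jordanian.coprodJ k,
    Jordanian.coprodJ_isJordanianCoproduct k,
    fun D' hD' => Jordanian.isJordanianCoproduct_unique k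
      (Jordanian.coprodJ_isJordanianCoproduct k) hD',
    Jordanian.twistUnit k, Jordanian.twistUnit_val k, fun J hJ => ?_,
    Jordanian.twistUnit_isTwist k, Jordanian.twistUnit_factorizes, fun F FS h hF hR => ?_⟩
  · have he := Jordanian.twistEquiv_isMinimalTwistMap k
    exact Jordanian.Ucl.algHom_ext (hf.onPlus.trans he.onPlus.symm)
      (hf.onZero.trans he.onZero.symm) (hf.onMinus.trans he.onMinus.symm)
  · have hc := Jordanian.coprodTransported_of_mem k hJ
    exact ⟨(Jordanian.twistUnit_isTwist k J).trans hc, hc⟩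
  · exact ⟨Jordanian.twistUnit_factorizes.flip_eq hR h,
      fun J _ => (Jordanian.twistUnit_isTwist k).conj_eq hF h J⟩
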